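/- Let $(\Omega,\mathcal F,\Pr)$ be a probability space and let $T:\Omega\times S^{2}\to\mathbb R$ be a jointly measurable Gaussian isotropic random field on the unit sphere $S^{2}\subset\mathbb R^{3}$: all finite-dimensional distributions of $T$ are Gaussian, and for every rotation $g\in SO(3)$ the fields $T(\cdot)$ and $T(g\,\cdot)$ have the same law. Let $dx$ be the surface measure on $S^2$ (total mass $4\pi$). Let $\{Y_{\ell m}\}_{\ell\ge 0,\,-\ell\le m\le \ell}$ be the complex spherical harmonics: for $m\ge 0$, $$Y_{\ell m}(\theta,\varphi)=\sqrt{\frac{2\ell+1}{4\pi}\frac{(\ell-m)!}{(\ell+m)!}}\;P_{\ell}^{m}(\cos\theta)e^{im\varphi},\qquad P_\ell^m(z)=(-1)^m(1-z^2)^{m/2}\frac{d^m}{dz^m}P_\ell(z),$$ with $P_\ell$ the Legendre polynomials, and $Y_{\ell,-m}=(-1)^m\overline{Y_{\ell m}}$. Let $\{Y^{\mathcal R}_{\ell m}\}$ be the real spherical harmonics: $Y^{\mathcal R}_{\ell 0}=Y_{\ell 0}$, $Y^{\mathcal R}_{\ell m}=\sqrt2\,\mathrm{Re}\,Y_{\ell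 m}$ for $m>0$, and $Y^{\mathcal R}_{\ell m}=\sqrt2\,\mathrm{Im}\,Y_{\ell,-m}$ for $m<0$. (Complex-valued scheme.) For $\alpha=\{\alpha_{\ell m}\}$ in the complex space $\ell^1$ put $\Psi\alpha=\sum_{\ell m}\alpha_{\ell m}Y_{\ell m}$. Then for all $\delta,\varepsilon>0$ there exists $\lambda=\lambda(\delta,\varepsilon)>0$ such that, almost surely, the problem $$\min_{\alpha\in\ell^1}\Big\{\lambda\|\alpha\|_{\ell^1}+\tfrac12\|T-\Psi\alpha\|_{L^2(S^2)}^2\Big\}$$ has exactly one solution $\alpha^{reg}$; its coefficients are random variables (after modification on a null set), and $$\Pr\big\{\|T-\Psi\alpha^{reg}\|_{L^2(S^2)}<\varepsilon\big\}\ge 1-\delta$$ (so the same bound holds for the event with $\le\varepsilon$). (Real-valued scheme.) The same holds with real coefficient arrays $\alpha\in\ell^1$ and with $Y^{\mathcal R}_{\ell m}$ in place of $Y_{\ell m}$. In both schemes the penalized and constrained formulations are stochastically equivalent in the following sense: almost surely, $\alpha^{reg}$ has the least $\ell^1$ norm among all $\alpha\in\ell^1$ with $\|T-\Psi\alpha\|_{L^2(S^2)}\le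 r$, where the random tolerance $r=\|T-\Psi\alpha^{reg}\|_{L^2(S^2)}$ satisfies $r<\varepsilon$ with probability at least $1-\delta$. -/

import Mathlib

open MeasureTheory ProbabilityTheory
open scoped ENNReal Nat

noncomputable section

namespace SphericalL1

/-- Euclidean three-space. -/
abbrev E3 : Type := EuclideanSpace ℝ (Fin 3)

/-- The unit sphere in three-space. -/
abbrev S2 : Type := Metric.sphere (0 : E3) 1

/-- The surface (Lebesgue) measure on the sphere, of total mass `4 * π`. -/
abbrev surface : Measure S2 := (volume : Measure E3).toSphere

/-! ### Isotropic random fields -/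

/-- The action of a linear isometry of three-space on the sphere. -/
def rotate (g : E3 ≃ₗᵢ[ℝ] E3) (x : S2) : S2 :=
  ⟨g (x : E3), by simp⟩

/-- A random field on the sphere is isotropic if, for every rotation `g` (an isometry of
determinant one), the laws of `T(·)` and of `T(g ·)` on the product space of all real functions on
the sphere coincide; that is, all their finite-dimensional distributions coincide. -/
def IsIsotropic {Ω : Type*} [MeasurableSpace Ω] (P : Measure Ω) (T : Ω → S2 → ℝ) : Prop :=
  ∀ g : E3 ≃ₗᵢ[ℝ] E3, LinearMap.det (g.toLinearEquiv : E3 →ₗ[ℝ] E3) = 1 →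
    P.map (fun ω (x : S2) => T ω (rotate g x)) = P.map T

/-! ### Spherical harmonics -/

/-- The Legendre polynomial, by the formula of Rodrigues. -/
def legendreP (l : ℕ) : Polynomial ℝ :=
  Polynomial.C (1 / ((2 : ℝ) ^ l * (l ! : ℝ))) *
    Polynomial.derivative^[l] ((Polynomial.X ^ 2 - 1) ^ l)

/-- The complex spherical harmonic of degree `l` and order `m`, for `0 ≤ m ≤ l`. In polar
coordinates the factor `(-1) ^ m * (x₀ + i x₁) ^ m * (d/dz) ^ m P_l (z)` at `z = x₂ = cos θ` is
the product of the associated Legendre function of `cos θ` and `exp (i m φ)`. -/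
def sphHarmNonneg (l m : ℕ) (x : S2) : ℂ :=
  (-1) ^ m *
    (Real.sqrt ((2 * l + 1) / (4 * Real.pi) * (((l - m)! : ℝ) / ((l + m)! : ℝ))) : ℂ) *
    ((x.1 0 : ℂ) + (x.1 1 : ℂ) * Complex.I) ^ m *
    (((Polynomial.derivative^[m] (legendreP l)).eval (x.1 2) : ℝ) : ℂ)

/-- The complex spherical harmonic of degree `l` and order `m`, for `-l ≤ m ≤ l`. -/
def sphHarm (l : ℕ) (m : ℤ) (x : S2) : ℂ :=
  if 0 ≤ m then sphHarmNonneg l m.natAbs x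
  else (-1) ^ m.natAbs * (starRingEnd ℂ) (sphHarmNonneg l m.natAbs x)

/-- The real spherical harmonic of degree `l` and order `m`, for `-l ≤ m ≤ l`. -/
def realSphHarm (l : ℕ) (m : ℤ) (x : S2) : ℝ :=
  if m = 0 then (sphHarm l 0 x).re
  else if 0 < m then Real.sqrt 2 * (sphHarm l m x).re
  else Real.sqrt 2 * (sphHarm l (-m) x).im

theorem continuous_sphHarmNonneg (l m : ℕ) : Continuous (sphHarmNonneg l m) := by
  unfold sphHarmNonneg
  fun_prop

theorem continuous_sphHarm (l : ℕ) (m : ℤ) : Continuous (sphHarm l m) := by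
  have h := continuous_sphHarmNonneg l m.natAbs
  unfold sphHarm
  by_cases hm : 0 ≤ m
  · simpa [hm] using h
  · simp only [hm, if_false]
    exact continuous_const.mul (Complex.continuous_conj.comp h)

theorem continuous_realSphHarm (l : ℕ) (m : ℤ) : Continuous (realSphHarm l m) := by
  unfold realSphHarm
  split_ifs
  · exact Complex.continuous_re.comp (continuous_sphHarm l 0)
  · exact continuous_const.mul (Complex.continuous_re.comp (continuous_sphHarm l m))
  · exact continuous_const.mul (Complex.continuous_im.comp (continuous_sphHarm l (-m)))

/-- The index set of the dictionary: pairs `(l, m)` with `l ≥ 0` and `-l ≤ m ≤ l`. -/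
abbrev HarmIndex : Type := Σ l : ℕ, {m : ℤ // m.natAbs ≤ l}

/-- The dictionary of complex spherical harmonics, in the complex space `L²` of the sphere. -/
def complexDict (i : HarmIndex) : Lp ℂ 2 surface :=
  ContinuousMap.toLp 2 surface ℂ ⟨sphHarm i.1 i.2.1, continuous_sphHarm i.1 i.2.1⟩

/-- The dictionary of real spherical harmonics, in the real space `L²` of the sphere. -/
def realDict (i : HarmIndex) : Lp ℝ 2 surface :=
  ContinuousMap.toLp 2 surface ℝ ⟨realSphHarm i.1 i.2.1, continuous_realSphHarm i.1 i.2.1⟩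

/-! ### Penalized and constrained problems -/

/-- Absolutely summable arrays of coefficients, with the `ℓ¹` norm. -/
abbrev Coeffs (𝕜 : Type*) [RCLike 𝕜] : Type _ := lp (fun _ : HarmIndex => 𝕜) 1

variable {𝕜 : Type*} [RCLike 𝕜]

/-- The synthesis operator `a ↦ ∑ a_i Y_i`, a series in `L²`. For the two dictionaries above it
converges absolutely, as their elements have norm one. -/
def synth (Y : HarmIndex → Lp 𝕜 2 surface) (a : Coeffs 𝕜) : Lp 𝕜 2 surface :=
  ∑' i, a i • Y i

/-- The reconstruction error, that is, the `L²` norm of `f - ∑ a_i Y_i` (infinite if `f` is not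
square integrable). -/
def residual (Y : HarmIndex → Lp 𝕜 2 surface) (f : S2 → ℝ) (a : Coeffs 𝕜) : ℝ≥0∞ :=
  eLpNorm (fun x => (f x : 𝕜) - synth Y a x) 2 surface

/-- The penalized functional. -/
def objective (Y : HarmIndex → Lp 𝕜 2 surface) (lam : ℝ) (f : S2 → ℝ) (a : Coeffs 𝕜) : ℝ≥0∞ :=
  ENNReal.ofReal (lam * ‖a‖) + residual Y f a ^ 2 / 2

/-- `a` solves the penalized problem with parameter `lam`. -/
def IsPenalizedSolution (Y : HarmIndex → Lp 𝕜 2 surface) (lam : ℝ) (f : S2 → ℝ)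
    (a : Coeffs 𝕜) : Prop :=
  ∀ b : Coeffs 𝕜, objective Y lam f a ≤ objective Y lam f b

/-- `a` solves the constrained problem with tolerance `r`: it has the least `ℓ¹` norm among the
arrays whose reconstruction error is at most `r`. -/
def IsConstrainedSolution (Y : HarmIndex → Lp 𝕜 2 surface) (r : ℝ≥0∞) (f : S2 → ℝ)
    (a : Coeffs 𝕜) : Prop :=
  residual Y f a ≤ r ∧ ∀ b : Coeffs 𝕜, residual Y f b ≤ r → ‖a‖ ≤ ‖b‖

end SphericalL1

end

/-! An orthonormal basis `Y` of `L²` decouples the penalized problem. With `c i` the Fourier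
coefficients of the field, Parseval turns the objective into the sum over `i` of `lam * ‖a i‖ + ‖c i
- a i‖ ^ 2 / 2`, and each term has soft thresholding of `c i` as its unique minimizer. As `c` is
square summable, only finitely many thresholded coefficients are nonzero, so the minimizer lies in
`ℓ¹`. Thresholding moves each coefficient by at most `min ‖c i‖ lam`; dominated convergence makes
the residual tend to zero with `lam` for every square integrable realization, and continuity of the
probability along increasing events gives one deterministic `lam` for given `δ` and `ε`. A penalized
minimizer solves the constrained problem whose tolerance is its own residual, by comparing
objectives.

Two facts feed this argument. The realizations are almost surely in `L²`: isotropy makes the second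
moment, finite by Gaussianity, bounded over the sphere, and Tonelli applies. And both dictionaries
are orthonormal bases: rotations about the axis separate different orders, the uniform distribution
of the height (`isInterval_heightIntegral`) reduces equal orders to associated Legendre polynomials
(`IsInterval.assoc_legendre`), and Stone–Weierstrass gives completeness. The real dictionary
inherits both properties from the complex one. -/

noncomputable section

namespace SphericalL1

/-! ### Soft thresholding of a scalar -/

section Shrinkage

open Filter Topology

variable {𝕜 : Type*} [RCLike 𝕜]

/-- Soft thresholding: the proximal map of `lam * ‖·‖`. -/
def shrink (lam : ℝ) (c : 𝕜) : 𝕜 :=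
  if ‖c‖ ≤ lam then 0 else ((1 - lam / ‖c‖ : ℝ) : 𝕜) * c

theorem norm_sub_shrink_le {lam : ℝ} (hlam : 0 < lam) (c : 𝕜) : ‖c - shrink lam c‖ ≤ lam := by
  unfold shrink
  split_ifs with h
  · simpa using h
  · have hc : 0 < ‖c‖ := hlam.trans (not_le.1 h)
    have : c - ((1 - lam / ‖c‖ : ℝ) : 𝕜) * c = ((lam / ‖c‖ : ℝ) : 𝕜) * c := by
      push_cast; ring
    rw [this, norm_mul, RCLike.norm_ofReal, abs_of_pos (by positivity)]
    exact (div_mul_cancel₀ _ hc.ne').le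

theorem norm_sub_shrink_le_norm {lam : ℝ} (hlam : 0 < lam) (c : 𝕜) :
    ‖c - shrink lam c‖ ≤ ‖c‖ := by
  by_cases h : ‖c‖ ≤ lam
  · simp [shrink, h]
  · exact (norm_sub_shrink_le hlam c).trans (not_le.1 h).le

/-- Together with `norm_sub_shrink_le`, this is the optimality condition: `c - shrink lam c` is a
subgradient of `lam * ‖·‖` at `shrink lam c`. -/
theorem re_inner_sub_shrink {lam : ℝ} (hlam : 0 < lam) (c : 𝕜) :
    RCLike.re (inner 𝕜 (c - shrink lam c) (shrink lam c)) = lam * ‖shrink lam c‖ := by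
  unfold shrink
  split_ifs with h
  · simp
  · have hc : 0 < ‖c‖ := hlam.trans (not_le.1 h)
    have h1 : 0 < 1 - lam / ‖c‖ := by
      rw [sub_pos, div_lt_one hc]; exact not_le.1 h
    have : c - ((1 - lam / ‖c‖ : ℝ) : 𝕜) * c = ((lam / ‖c‖ : ℝ) : 𝕜) * c := by
      push_cast; ring
    rw [this, norm_mul, RCLike.norm_ofReal, abs_of_pos h1, ← smul_eq_mul, ← smul_eq_mul,
      inner_smul_left, inner_smul_right, inner_self_eq_norm_sq_to_K]
    simp only [RCLike.conj_ofReal]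
    rw [RCLike.re_ofReal_mul, RCLike.re_ofReal_mul, ← RCLike.ofReal_pow, RCLike.ofReal_re]
    field_simp

/-- Strong convexity of the scalar problem: expand `‖c - z‖ ^ 2` around the minimizer and bound the
cross term by the subgradient inequality. The quadratic excess gives minimality and uniqueness at
once. -/
theorem shrink_gap {lam : ℝ} (hlam : 0 < lam) (c z : 𝕜) :
    lam * ‖shrink lam c‖ + ‖c - shrink lam c‖ ^ 2 / 2 + ‖z - shrink lam c‖ ^ 2 / 2 ≤
      lam * ‖z‖ + ‖c - z‖ ^ 2 / 2 := by
  set s := shrink lam c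
  have h1 : RCLike.re (inner 𝕜 (c - s) s) = lam * ‖s‖ := re_inner_sub_shrink hlam c
  have h2 : RCLike.re (inner 𝕜 (c - s) z) ≤ lam * ‖z‖ :=
    ((RCLike.re_le_norm _).trans (norm_inner_le_norm _ _)).trans
      (mul_le_mul_of_nonneg_right (norm_sub_shrink_le hlam c) (norm_nonneg z))
  have h3 : ‖c - z‖ ^ 2 =
      ‖c - s‖ ^ 2 - 2 * RCLike.re (inner 𝕜 (c - s) (z - s)) + ‖z - s‖ ^ 2 := by
    rw [← norm_sub_sq (𝕜 := 𝕜)]; congr 2; ring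
  rw [inner_sub_right, map_sub] at h3
  linarith

theorem measurable_shrink (lam : ℝ) : Measurable (shrink lam : 𝕜 → 𝕜) := by
  unfold shrink
  refine Measurable.ite (measurableSet_le measurable_norm measurable_const) measurable_const ?_
  exact (RCLike.measurable_ofReal.comp
    (measurable_const.sub (measurable_const.div measurable_norm))).mul measurable_id

theorem finite_support_shrink {ι : Type*} {lam : ℝ} (hlam : 0 < lam) {c : ι → 𝕜}
    (hc : Summable fun i => ‖c i‖ ^ 2) : {i | shrink lam (c i) ≠ 0}.Finite := by
  have h : ∀ᶠ i in cofinite, ‖c i‖ ^ 2 < lam ^ 2 :=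
    hc.tendsto_cofinite_zero.eventually (gt_mem_nhds (by positivity))
  refine h.subset fun i hi hlt => hi ?_
  have : ‖c i‖ ≤ lam := (lt_of_pow_lt_pow_left₀ 2 hlam.le hlt).le
  simp [shrink, this]

end Shrinkage

/-! ### The penalized problem for a fixed square integrable function -/

section Deterministic

open Filter Topology

variable {𝕜 : Type*} [RCLike 𝕜] {Y : HarmIndex → Lp 𝕜 2 surface}

theorem Coeffs.norm_eq (a : Coeffs 𝕜) : ‖a‖ = ∑' i, ‖a i‖ := by
  simp [lp.norm_eq_tsum_rpow (p := 1) (by simp) a]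

theorem Coeffs.summable_norm (a : Coeffs 𝕜) : Summable fun i => ‖a i‖ := by
  simpa using (lp.memℓp a).summable (by simp)

theorem hasSum_synth (hY : Orthonormal 𝕜 Y) (a : Coeffs 𝕜) :
    HasSum (fun i => a i • Y i) (synth Y a) := by
  refine (Summable.of_norm ?_).hasSum
  simpa [norm_smul, hY.1] using Coeffs.summable_norm a

theorem inner_synth (hY : Orthonormal 𝕜 Y) (a : Coeffs 𝕜) (i : HarmIndex) :
    inner 𝕜 (Y i) (synth Y a) = a i := by
  have h := (hasSum_synth hY a).mapL (innerSL 𝕜 (Y i))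
  refine h.unique ?_
  have h0 : innerSL 𝕜 (Y i) (a i • Y i) = a i := by
    simp [inner_self_eq_norm_sq_to_K, hY.1]
  have h1 := hasSum_single (f := fun j => innerSL 𝕜 (Y i) (a j • Y j)) i fun j hj => by
    simp [hY.2 hj.symm]
  rwa [h0] at h1

theorem hasSum_parseval (hY : Orthonormal 𝕜 Y) (hc : (Submodule.span 𝕜 (Set.range Y))ᗮ = ⊥)
    (F : Lp 𝕜 2 surface) : HasSum (fun i => ‖inner 𝕜 (Y i) F‖ ^ 2) (‖F‖ ^ 2) := by
  have h := (HilbertBasis.mkOfOrthogonalEqBot hY hc).hasSum_inner_mul_inner F F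
  rw [inner_self_eq_norm_sq_to_K] at h
  have h2 := h.mapL RCLike.reCLM
  convert! h2 using 1
  · ext i
    simp only [HilbertBasis.coe_mkOfOrthogonalEqBot, RCLike.reCLM_apply]
    rw [← inner_conj_symm F (Y i), RCLike.conj_mul, ← RCLike.ofReal_pow, RCLike.ofReal_re]
  · rw [RCLike.reCLM_apply, ← RCLike.ofReal_pow, RCLike.ofReal_re]

theorem hasSum_parseval_sub (hY : Orthonormal 𝕜 Y)
    (hc : (Submodule.span 𝕜 (Set.range Y))ᗮ = ⊥) (F : Lp 𝕜 2 surface) (a : Coeffs 𝕜) :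
    HasSum (fun i => ‖inner 𝕜 (Y i) F - a i‖ ^ 2) (‖F - synth Y a‖ ^ 2) := by
  simpa [inner_sub_right, inner_synth hY] using hasSum_parseval hY hc (F - synth Y a)

/-- The soft thresholded Fourier coefficients of `F`. -/
def shrinkCoeffs (hY : Orthonormal 𝕜 Y) {lam : ℝ} (hlam : 0 < lam) (F : Lp 𝕜 2 surface) :
    Coeffs 𝕜 :=
  ⟨fun i => shrink lam (inner 𝕜 (Y i) F), memℓp_gen (by
    simpa using summable_of_hasFiniteSupport (f := fun i => ‖shrink lam (inner 𝕜 (Y i) F)‖)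
      (by simpa [Function.HasFiniteSupport, Function.support] using
        finite_support_shrink hlam (hY.inner_products_summable F)))⟩

theorem hasSum_objective (hY : Orthonormal 𝕜 Y)
    (hc : (Submodule.span 𝕜 (Set.range Y))ᗮ = ⊥) (lam : ℝ) (F : Lp 𝕜 2 surface)
    (a : Coeffs 𝕜) :
    HasSum (fun i => lam * ‖a i‖ + ‖inner 𝕜 (Y i) F - a i‖ ^ 2 / 2)
      (lam * ‖a‖ + ‖F - synth Y a‖ ^ 2 / 2) := by
  rw [Coeffs.norm_eq a]
  exact ((Coeffs.summable_norm a).hasSum.mul_left lam).add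
    ((hasSum_parseval_sub hY hc F a).div_const 2)

/-- Sum `shrink_gap` over all indices, keeping the quadratic excess only at `j`; since `j` is
arbitrary, this suffices for uniqueness. -/
theorem objective_gap (hY : Orthonormal 𝕜 Y)
    (hc : (Submodule.span 𝕜 (Set.range Y))ᗮ = ⊥) {lam : ℝ} (hlam : 0 < lam)
    (F : Lp 𝕜 2 surface) (b : Coeffs 𝕜) (j : HarmIndex) :
    lam * ‖shrinkCoeffs hY hlam F‖ + ‖F - synth Y (shrinkCoeffs hY hlam F)‖ ^ 2 / 2 +
      ‖b j - shrinkCoeffs hY hlam F j‖ ^ 2 / 2 ≤ lam * ‖b‖ + ‖F - synth Y b‖ ^ 2 / 2 := by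
  classical
  have h1 := hasSum_objective hY hc lam F (shrinkCoeffs hY hlam F)
  have h2 := hasSum_objective hY hc lam F b
  have h3 := hasSum_ite_eq j (‖b j - shrinkCoeffs hY hlam F j‖ ^ 2 / 2)
  refine hasSum_le (fun i => ?_) (h1.add h3) h2
  have h4 := shrink_gap hlam (inner 𝕜 (Y i) F) (b i)
  split_ifs with hij
  · subst hij; exact h4
  · rw [add_zero]
    exact le_trans (le_add_of_nonneg_right (by positivity)) h4

theorem residual_eq {f : S2 → ℝ} (hf : MemLp (fun x => (f x : 𝕜)) 2 surface) (a : Coeffs 𝕜) :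
    residual Y f a = ENNReal.ofReal ‖hf.toLp _ - synth Y a‖ := by
  rw [residual, ofReal_norm, Lp.enorm_def]
  refine eLpNorm_congr_ae ?_
  filter_upwards [Lp.coeFn_sub (hf.toLp _) (synth Y a), hf.coeFn_toLp] with x h1 h2
  rw [h1, Pi.sub_apply, h2]

theorem objective_eq {f : S2 → ℝ} (hf : MemLp (fun x => (f x : 𝕜)) 2 surface) {lam : ℝ}
    (hlam : 0 < lam) (a : Coeffs 𝕜) :
    objective Y lam f a =
      ENNReal.ofReal (lam * ‖a‖ + ‖hf.toLp _ - synth Y a‖ ^ 2 / 2) := by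
  rw [objective, residual_eq hf, ENNReal.ofReal_add (by positivity) (by positivity),
    ENNReal.ofReal_div_of_pos two_pos, ENNReal.ofReal_pow (norm_nonneg _)]
  simp

theorem isPenalizedSolution_iff (hY : Orthonormal 𝕜 Y)
    (hc : (Submodule.span 𝕜 (Set.range Y))ᗮ = ⊥) {lam : ℝ} (hlam : 0 < lam) {f : S2 → ℝ}
    (hf : MemLp (fun x => (f x : 𝕜)) 2 surface) (b : Coeffs 𝕜) :
    IsPenalizedSolution Y lam f b ↔ b = shrinkCoeffs hY hlam (hf.toLp _) := by
  constructor
  · intro h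
    have h1 := h (shrinkCoeffs hY hlam (hf.toLp _))
    rw [objective_eq hf hlam, objective_eq hf hlam, ENNReal.ofReal_le_ofReal_iff (by positivity)]
      at h1
    refine lp.ext (funext fun j => ?_)
    have h2 := objective_gap hY hc hlam (hf.toLp _) b j
    have h3 : ‖b j - shrinkCoeffs hY hlam (hf.toLp _) j‖ ^ 2 ≤ 0 := by linarith
    exact sub_eq_zero.1 (norm_eq_zero.1 (pow_eq_zero_iff two_ne_zero |>.1
      (le_antisymm h3 (by positivity))))
  · rintro rfl c
    rw [objective_eq hf hlam, objective_eq hf hlam]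
    refine ENNReal.ofReal_le_ofReal ?_
    -- Any index serves here, since the quadratic excess is discarded.
    have h2 := objective_gap hY hc hlam (hf.toLp _) c ⟨0, 0, le_rfl⟩
    exact le_trans (le_add_of_nonneg_right (by positivity)) h2

/-- A competitor with no larger residual and a smaller norm would have a smaller objective.
Orthonormality plays no role. -/
theorem IsPenalizedSolution.isConstrainedSolution {lam : ℝ} (hlam : 0 < lam) {f : S2 → ℝ}
    (hf : MemLp (fun x => (f x : 𝕜)) 2 surface) {a : Coeffs 𝕜}
    (ha : IsPenalizedSolution Y lam f a) :
    IsConstrainedSolution Y (residual Y f a) f a := by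
  refine ⟨le_rfl, fun b hb => ?_⟩
  have h := ha b
  rw [objective_eq hf hlam, objective_eq hf hlam, ENNReal.ofReal_le_ofReal_iff (by positivity)]
    at h
  rw [residual_eq hf, residual_eq hf, ENNReal.ofReal_le_ofReal_iff (norm_nonneg _)] at hb
  have h2 := pow_le_pow_left₀ (norm_nonneg _) hb 2
  exact le_of_mul_le_mul_left (by linarith) hlam

/-- Each term of the Parseval series of the error is at most `lam n ^ 2`, hence tends to zero, and
is dominated by the squared Fourier coefficient, which is summable. -/
theorem tendsto_norm_sub_synth_shrinkCoeffs (hY : Orthonormal 𝕜 Y)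
    (hc : (Submodule.span 𝕜 (Set.range Y))ᗮ = ⊥) {lam : ℕ → ℝ} (hlam : ∀ n, 0 < lam n)
    (hlim : Tendsto lam atTop (𝓝 0)) (F : Lp 𝕜 2 surface) :
    Tendsto (fun n => ‖F - synth Y (shrinkCoeffs hY (hlam n) F)‖) atTop (𝓝 0) := by
  have h : Tendsto (fun n => ‖F - synth Y (shrinkCoeffs hY (hlam n) F)‖ ^ 2) atTop (𝓝 0) := by
    simp_rw [← fun n => (hasSum_parseval_sub hY hc F (shrinkCoeffs hY (hlam n) F)).tsum_eq]
    have key := tendsto_tsum_of_dominated_convergence (𝓕 := atTop)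
      (f := fun n i => ‖inner 𝕜 (Y i) F - shrinkCoeffs hY (hlam n) F i‖ ^ 2)
      (g := fun _ => (0 : ℝ)) (hasSum_parseval hY hc F).summable (fun i => ?_) ?_
    · simpa using key
    · have h0 : Tendsto (fun n => lam n ^ 2) atTop (𝓝 0) := by simpa using hlim.pow 2
      refine squeeze_zero (fun n => by positivity) (fun n => ?_) h0
      exact pow_le_pow_left₀ (norm_nonneg _) (norm_sub_shrink_le (hlam n) _) 2
    · refine Eventually.of_forall fun n i => ?_
      rw [Real.norm_of_nonneg (by positivity)]
      exact pow_le_pow_left₀ (norm_nonneg _) (norm_sub_shrink_le_norm (hlam n) _) 2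
  simpa [Real.sqrt_sq (norm_nonneg _)] using h.sqrt

end Deterministic

/-! ### Measurability and the choice of the penalty -/

section Random

open Filter Topology

variable {𝕜 : Type*} [RCLike 𝕜] {Y : HarmIndex → Lp 𝕜 2 surface}

/-- For a dictionary that is an orthonormal basis of `L²`, and a random field with square
integrable realizations. -/
theorem exists_penalty_of_orthonormal (hY : Orthonormal 𝕜 Y)
    (hc : (Submodule.span 𝕜 (Set.range Y))ᗮ = ⊥) {Ω : Type*} [MeasurableSpace Ω]
    (P : Measure Ω) [IsProbabilityMeasure P] (T : Ω → S2 → ℝ)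
    (hT : Measurable (Function.uncurry T)) (hL2 : ∀ᵐ ω ∂P, MemLp (T ω) 2 surface)
    {δ ε : ℝ} (hδ : 0 < δ) (hε : 0 < ε) :
    ∃ lam : ℝ, 0 < lam ∧ ∃ a : Ω → Coeffs 𝕜,
      (∀ i, Measurable fun ω => a ω i) ∧
      (∀ᵐ ω ∂P, ∀ b, IsPenalizedSolution Y lam (T ω) b ↔ b = a ω) ∧
      (∀ᵐ ω ∂P, IsConstrainedSolution Y (residual Y (T ω) (a ω)) (T ω) (a ω)) ∧
      ENNReal.ofReal (1 - δ) ≤ P {ω | residual Y (T ω) (a ω) < ENNReal.ofReal ε} := by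
  classical
  -- The value `0` off the square integrable realizations defines the solution for every `ω`. As
  -- that exceptional set is measurable (`hset`), the coefficients are measurable without discarding
  -- a null set.
  let F : Ω → Lp 𝕜 2 surface := fun ω =>
    if h : MemLp (fun x => (T ω x : 𝕜)) 2 surface then h.toLp _ else 0
  have hF : ∀ ω (h : MemLp (fun x => (T ω x : 𝕜)) 2 surface), F ω = h.toLp _ :=
    fun ω h => dif_pos h
  have hL2' : ∀ᵐ ω ∂P, MemLp (fun x => (T ω x : 𝕜)) 2 surface := by
    filter_upwards [hL2] with ω h using h.ofReal
  have hTK : Measurable (Function.uncurry fun ω x => (T ω x : 𝕜)) :=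
    RCLike.measurable_ofReal.comp hT
  have hset : MeasurableSet {ω | MemLp (fun x => (T ω x : 𝕜)) 2 surface} := by
    have : {ω | MemLp (fun x => (T ω x : 𝕜)) 2 surface} =
        {ω | ∫⁻ x, ‖(T ω x : 𝕜)‖ₑ ^ (2 : ℝ) ∂surface < ∞} := by
      ext ω
      have hm : AEStronglyMeasurable (fun x => (T ω x : 𝕜)) surface :=
        (hTK.comp measurable_prodMk_left).aestronglyMeasurable
      simp only [Set.mem_ofPred_eq, MemLp, hm, true_and]
      rw [eLpNorm_lt_top_iff_lintegral_rpow_enorm_lt_top two_ne_zero ENNReal.ofNat_ne_top]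
      simp
    rw [this]
    exact measurableSet_lt (Measurable.lintegral_prod_right (hTK.enorm.pow_const _))
      measurable_const
  have hcoef : ∀ i, Measurable fun ω => inner 𝕜 (Y i) (F ω) := by
    intro i
    have h1 : (fun ω => inner 𝕜 (Y i) (F ω)) = Set.indicator
        {ω | MemLp (fun x => (T ω x : 𝕜)) 2 surface}
        (fun ω => ∫ x, inner 𝕜 (Y i x) (T ω x : 𝕜) ∂surface) := by
      ext ω
      by_cases h : MemLp (fun x => (T ω x : 𝕜)) 2 surface
      · rw [Set.indicator_of_mem (by exact h), hF ω h, L2.inner_def]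
        refine integral_congr_ae ?_
        filter_upwards [h.coeFn_toLp] with x hx
        rw [hx]
      · rw [Set.indicator_of_notMem (by exact h)]
        simp [F, h]
    rw [h1]
    refine Measurable.indicator ?_ hset
    refine StronglyMeasurable.measurable (StronglyMeasurable.integral_prod_right
      (f := fun ω x => inner 𝕜 (Y i x) (T ω x : 𝕜)) ?_)
    exact ((Lp.stronglyMeasurable (Y i)).comp_measurable measurable_snd).inner
      hTK.stronglyMeasurable
  let lam : ℕ → ℝ := fun n => 1 / ((n : ℝ) + 1)
  have hlam : ∀ n, 0 < lam n := fun n => Nat.one_div_pos_of_nat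
  have hlim : Tendsto lam atTop (𝓝 0) := tendsto_one_div_add_atTop_nhds_zero_nat
  let A : ℕ → Set Ω := fun n =>
    {ω | residual Y (T ω) (shrinkCoeffs hY (hlam n) (F ω)) < ENNReal.ofReal ε}
  have hA : ∀ᵐ ω ∂P, ω ∈ ⋃ N, ⋂ n ≥ N, A n := by
    filter_upwards [hL2'] with ω h
    have h1 := tendsto_norm_sub_synth_shrinkCoeffs hY hc hlam hlim (F ω)
    obtain ⟨N, hN⟩ := eventually_atTop.1 (h1.eventually (gt_mem_nhds hε))
    refine Set.mem_iUnion.2 ⟨N, Set.mem_iInter₂.2 fun n hn => ?_⟩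
    simp only [A, Set.mem_ofPred_eq]
    rw [residual_eq h, ← hF ω h]
    exact (ENNReal.ofReal_lt_ofReal_iff hε).2 (hN n hn)
  -- Passing to tails gives increasing events without comparing different penalties; continuity from
  -- below then needs no measurability of `A n`.
  have hmono : Monotone fun N => ⋂ n ≥ N, A n := fun N M hNM =>
    Set.biInter_subset_biInter_left fun n hn => le_trans hNM hn
  have hsup : ⨆ N, P (⋂ n ≥ N, A n) = 1 := by
    rw [← hmono.measure_iUnion]
    exact (measure_congr (eventuallyEq_univ.2 hA)).trans measure_univ
  obtain ⟨N, hN⟩ : ∃ N, ENNReal.ofReal (1 - δ) < P (⋂ n ≥ N, A n) := by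
    rw [← lt_iSup_iff, hsup]
    rw [ENNReal.ofReal_lt_one]
    linarith
  refine ⟨lam N, hlam N, fun ω => shrinkCoeffs hY (hlam N) (F ω), fun i => ?_, ?_, ?_, ?_⟩
  · exact (measurable_shrink _).comp (hcoef i)
  · filter_upwards [hL2'] with ω h b
    rw [hF ω h]
    exact isPenalizedSolution_iff hY hc (hlam N) h b
  · filter_upwards [hL2'] with ω h
    refine IsPenalizedSolution.isConstrainedSolution (hlam N) h ?_
    rw [hF ω h]
    exact (isPenalizedSolution_iff hY hc (hlam N) h _).2 rfl
  · exact hN.le.trans (measure_mono (Set.biInter_subset_of_mem (Set.mem_Ici.2 le_rfl)))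

end Random

/-! ### Legendre polynomials and their derivatives, for an abstract integral -/

section Legendre

open Polynomial

variable {L : ℝ[X] →ₗ[ℝ] ℝ}

/-- `L` is integration over `[-1, 1]`, characterized by the fundamental theorem of calculus. -/
def IsInterval (L : ℝ[X] →ₗ[ℝ] ℝ) : Prop :=
  ∀ p : ℝ[X], L (derivative p) = p.eval 1 - p.eval (-1)

/-- Iterated integration by parts against a polynomial vanishing to order `n` at `±1`. -/
theorem IsInterval.iterate_parts (hL : IsInterval L) (n : ℕ) :
    ∀ (w q : ℝ[X]), (X ^ 2 - 1) ^ n ∣ w →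
      L (derivative^[n] w * q) = (-1) ^ n * L (w * derivative^[n] q) := by
  induction n with
  | zero => intro w q _; simp
  | succ n ih =>
    intro w q hw
    have h1 : (X ^ 2 - 1 : ℝ[X]) ^ n ∣ derivative w := by
      obtain ⟨v, rfl⟩ := hw
      rw [derivative_mul, derivative_pow_succ]
      refine dvd_add ?_ ?_
      · exact Dvd.dvd.mul_right (Dvd.dvd.mul_right (Dvd.intro_left _ rfl) _) _
      · exact Dvd.dvd.mul_right (pow_dvd_pow _ n.le_succ) _
    have h2 : ∀ x : ℝ, x ^ 2 = 1 → w.eval x = 0 := by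
      intro x hx
      obtain ⟨v, rfl⟩ := hw
      simp [hx]
    have h3 := hL (w * derivative^[n] q)
    rw [derivative_mul, map_add, eval_mul, eval_mul, h2 1 (by norm_num), h2 (-1) (by norm_num)]
      at h3
    rw [Function.iterate_succ_apply, ih _ _ h1, Function.iterate_succ_apply', pow_succ]
    linear_combination (-1) ^ n * h3

theorem derivative_iterate_eq_C {p : ℝ[X]} {n : ℕ} (h : p.natDegree ≤ n) :
    derivative^[n] p = C ((n ! : ℝ) * p.coeff n) := by
  ext k
  rw [coeff_iterate_derivative, coeff_C]
  split_ifs with hk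
  · subst hk
    simp [Nat.descFactorial_self]
  · rw [coeff_eq_zero_of_natDegree_lt (by omega)]
    simp

theorem natDegree_sq_sub_one_pow (n : ℕ) : ((X ^ 2 - 1 : ℝ[X]) ^ n).natDegree = 2 * n := by
  rw [natDegree_pow, ← C_1, natDegree_X_pow_sub_C, mul_comm]

theorem monic_sq_sub_one_pow (n : ℕ) : ((X ^ 2 - 1 : ℝ[X]) ^ n).Monic := by
  rw [← C_1]
  exact (monic_X_pow_sub_C _ two_ne_zero).pow n

theorem coeff_sq_sub_one_pow (n : ℕ) : ((X ^ 2 - 1 : ℝ[X]) ^ n).coeff (2 * n) = 1 := by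
  have h := (monic_sq_sub_one_pow n).coeff_natDegree
  rwa [natDegree_sq_sub_one_pow] at h

theorem natDegree_legendreP_le (l : ℕ) : (legendreP l).natDegree ≤ l := by
  refine (natDegree_C_mul_le _ _).trans ((natDegree_iterate_derivative _ _).trans ?_)
  rw [natDegree_sq_sub_one_pow]
  omega

theorem coeff_legendreP (l : ℕ) :
    (legendreP l).coeff l = (2 * l)! / (2 ^ l * (l ! : ℝ) ^ 2) := by
  have h : (2 * l).descFactorial l = (2 * l)! / l ! := by
    rw [Nat.descFactorial_eq_div (by omega)]; congr 2; omega
  rw [legendreP, coeff_C_mul, coeff_iterate_derivative, ← two_mul, coeff_sq_sub_one_pow, h,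
    nsmul_eq_mul, Nat.cast_div (Nat.factorial_dvd_factorial (by omega)) (by positivity)]
  field_simp

/-- The normalizing integral of Rodrigues' formula. -/
theorem IsInterval.apply_sq_sub_one_pow (hL : IsInterval L) (n : ℕ) :
    L ((X ^ 2 - 1) ^ n) = (-1) ^ n * 2 ^ (2 * n + 1) * (n ! : ℝ) ^ 2 / (2 * n + 1)! := by
  induction n with
  | zero =>
    have h := hL X
    simp only [derivative_X, eval_X] at h
    simp only [pow_zero, h]
    norm_num
  | succ n ih =>
    -- This polynomial vanishes at `±1`, so the integral of its derivative is zero: `(2n + 3) I (n +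
    -- 1) + 2 (n + 1) I n = 0`, where `I n` is the integral of `(X ^ 2 - 1) ^ n`.
    have h := hL (X * (X ^ 2 - 1) ^ (n + 1))
    have h1 : derivative (X * (X ^ 2 - 1 : ℝ[X]) ^ (n + 1)) =
        (2 * (n : ℝ) + 3) • (X ^ 2 - 1) ^ (n + 1) + (2 * ((n : ℝ) + 1)) • (X ^ 2 - 1) ^ n := by
      simp only [derivative_mul, derivative_X, derivative_pow_succ, derivative_sub, derivative_one,
        smul_eq_C_mul]
      simp only [map_add, map_mul, map_natCast, map_ofNat, map_one]
      push_cast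
      ring
    rw [h1, map_add, map_smul, map_smul, ih] at h
    simp only [smul_eq_mul, eval_mul, eval_X, eval_pow, eval_sub, eval_one] at h
    norm_num at h
    have h2 : ((2 * (n + 1) + 1)! : ℝ) = (2 * n + 3) * (2 * (n + 1)) * (2 * n + 1)! := by
      have : 2 * (n + 1) + 1 = (2 * n + 1) + 1 + 1 := by ring
      rw [this, Nat.factorial_succ, Nat.factorial_succ]
      push_cast; ring
    have h3 : ((n + 1)! : ℝ) = (n + 1) * n ! := by rw [Nat.factorial_succ]; push_cast; ring
    have h4 : ((2 * n + 1)! : ℝ) ≠ 0 := by positivity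
    have h5 : (2 * (n : ℝ) + 3) ≠ 0 := by positivity
    have h6 : (n : ℝ) + 1 ≠ 0 := by positivity
    rw [h2, h3]
    have h7 : L ((X ^ 2 - 1) ^ (n + 1)) = -((2 * ((n : ℝ) + 1)) *
        ((-1) ^ n * 2 ^ (2 * n + 1) * (n ! : ℝ) ^ 2 / (2 * n + 1)!)) / (2 * n + 3) := by
      rw [eq_div_iff h5]; linarith
    rw [h7]
    field_simp
    ring

/-- Rodrigues' formula: a Legendre polynomial integrates polynomials of at most its degree. -/
theorem IsInterval.legendreP_mul (hL : IsInterval L) {l : ℕ} {q : ℝ[X]} (hq : q.natDegree ≤ l) :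
    L (legendreP l * q) =
      2 ^ (l + 1) * (l ! : ℝ) ^ 2 / (2 * l + 1)! * q.coeff l := by
  rw [legendreP, mul_assoc, ← smul_eq_C_mul, map_smul, hL.iterate_parts l _ _ dvd_rfl,
    derivative_iterate_eq_C hq, mul_comm _ (C _), ← smul_eq_C_mul, map_smul,
    hL.apply_sq_sub_one_pow, smul_eq_mul, smul_eq_mul]
  have : ((-1 : ℝ) ^ l) * (-1) ^ l = 1 := by rw [← mul_pow]; simp
  field_simp
  rw [show 2 * l + 1 = l + (l + 1) by ring, pow_add]
  linear_combination (q.coeff l * 2 ^ l * 2 ^ (l + 1)) * this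

/-- Integration by parts moves the `m` derivatives from `legendreP n` onto `w`. The result has
degree at most `l ≤ n`, so `IsInterval.legendreP_mul` sees only its coefficient of degree `n`: zero
if `l < n`, and read off from leading coefficients if `l = n`. -/
theorem IsInterval.assoc_legendre (hL : IsInterval L) {l n m : ℕ} (hml : m ≤ l) (hln : l ≤ n) :
    L ((1 - X ^ 2) ^ m * derivative^[m] (legendreP l) * derivative^[m] (legendreP n)) =
      if l = n then 2 / (2 * (l : ℝ) + 1) * (((l + m)! : ℝ) / ((l - m)! : ℝ)) else 0 := by
  set w : ℝ[X] := (X ^ 2 - 1) ^ m * derivative^[m] (legendreP l) with hw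
  have h1 : ((1 - X ^ 2 : ℝ[X]) ^ m * derivative^[m] (legendreP l) *
      derivative^[m] (legendreP n)) = C ((-1) ^ m) * (w * derivative^[m] (legendreP n)) := by
    rw [hw, show (1 - X ^ 2 : ℝ[X]) = C (-1) * (X ^ 2 - 1) by simp, mul_pow, C_pow]
    ring
  have h2 := hL.iterate_parts m w (legendreP n) (Dvd.intro _ rfl)
  have hd : (derivative^[m] (legendreP l)).natDegree ≤ l - m :=
    (natDegree_iterate_derivative _ _).trans (Nat.sub_le_sub_right (natDegree_legendreP_le l) m)
  have hdw : w.natDegree ≤ l + m := by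
    refine natDegree_mul_le.trans ?_
    rw [natDegree_sq_sub_one_pow]
    omega
  have hdd : (derivative^[m] w).natDegree ≤ l :=
    (natDegree_iterate_derivative _ _).trans (by omega)
  have h3 : L (w * derivative^[m] (legendreP n)) =
      (-1) ^ m * L (legendreP n * derivative^[m] w) := by
    rw [mul_comm (legendreP n), h2, ← mul_assoc, ← mul_pow]; simp
  rw [h1, ← smul_eq_C_mul, map_smul, h3, hL.legendreP_mul (hdd.trans hln), smul_eq_mul,
    ← mul_assoc, ← mul_pow]
  split_ifs with h
  · subst h
    have hcw : w.coeff (l + m) = (derivative^[m] (legendreP l)).coeff (l - m) := by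
      have := coeff_mul_add_eq_of_natDegree_le (natDegree_sq_sub_one_pow m).le hd
      rwa [coeff_sq_sub_one_pow, one_mul, show 2 * m + (l - m) = l + m by omega] at this
    rw [coeff_iterate_derivative, hcw, coeff_iterate_derivative, Nat.sub_add_cancel hml,
      coeff_legendreP, Nat.descFactorial_eq_div (by omega), Nat.descFactorial_eq_div hml,
      Nat.add_sub_cancel, nsmul_eq_mul, nsmul_eq_mul,
      Nat.cast_div (Nat.factorial_dvd_factorial (by omega)) (by positivity),
      Nat.cast_div (Nat.factorial_dvd_factorial (by omega)) (by positivity)]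
    have h4 : ((2 * l + 1)! : ℝ) = (2 * l + 1) * (2 * l)! := by
      rw [Nat.factorial_succ]; push_cast; ring
    rw [h4]
    have : (2 * (l : ℝ) + 1) ≠ 0 := by positivity
    norm_num
    field_simp
    ring
  · rw [coeff_eq_zero_of_natDegree_lt (by omega)]
    simp

end Legendre

/-! ### Rotation invariance of the surface measure and the law of the height -/

section SurfaceMeasure

open Polynomial Set
open scoped Pointwise

theorem continuous_rotate (g : E3 ≃ₗᵢ[ℝ] E3) : Continuous (rotate g) :=
  (g.continuous.comp continuous_subtype_val).subtype_mk _

/-- The surface measure of a set comes from the volume of the cone over it; `g` commutes with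
forming cones and preserves volume. The determinant may be `-1`, which admits the antipodal map. -/
theorem measurePreserving_rotate (g : E3 ≃ₗᵢ[ℝ] E3) :
    MeasurePreserving (rotate g) surface surface := by
  refine ⟨(continuous_rotate g).measurable, Measure.ext fun s hs => ?_⟩
  rw [Measure.map_apply (continuous_rotate g).measurable hs, Measure.toSphere_apply' _ hs,
    Measure.toSphere_apply' _ ((continuous_rotate g).measurable hs)]
  congr 1
  have h : Ioo (0 : ℝ) 1 • (Subtype.val '' (rotate g ⁻¹' s) : Set E3) =
      g ⁻¹' (Ioo (0 : ℝ) 1 • (Subtype.val '' s)) := by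
    ext x
    simp only [mem_smul, mem_image, mem_preimage, exists_exists_and_eq_and]
    constructor
    · rintro ⟨r, hr, y, hy, rfl⟩
      exact ⟨r, hr, rotate g y, hy, by simp [rotate]⟩
    · rintro ⟨r, hr, y, hy, h⟩
      have h1 : rotate g (rotate g.symm y) = y := Subtype.ext (by simp [rotate])
      refine ⟨r, hr, rotate g.symm y, by rwa [h1], ?_⟩
      apply g.injective
      simpa [rotate] using h
  rw [h]
  exact g.measurePreserving.measure_preimage_emb g.toHomeomorph.measurableEmbedding _

theorem integral_comp_rotate (g : E3 ≃ₗᵢ[ℝ] E3) {F : Type*} [NormedAddCommGroup F]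
    [NormedSpace ℝ F] {f : S2 → F} (hf : Continuous f) :
    ∫ x, f (rotate g x) ∂surface = ∫ x, f x ∂surface := by
  have h := integral_map (μ := surface) (continuous_rotate g).aemeasurable (f := f)
    hf.aestronglyMeasurable
  rw [(measurePreserving_rotate g).map_eq] at h
  exact h.symm

theorem integrable_of_continuous {F : Type*} [NormedAddCommGroup F] {f : S2 → F}
    (hf : Continuous f) : Integrable f surface :=
  hf.integrable_of_hasCompactSupport (HasCompactSupport.of_compactSpace f)

/-- Gaussian moments on the half-line. -/
theorem integral_pow_mul_exp_neg_sq (k : ℕ) :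
    ∫ r in Ioi (0 : ℝ), r ^ k * Real.exp (-r ^ 2) = 1 / 2 * Real.Gamma ((k + 1) / 2) := by
  have h := integral_rpow_mul_exp_neg_rpow (p := 2) (q := k) two_pos
    (by linarith [(Nat.cast_nonneg k : (0 : ℝ) ≤ k)])
  simpa using h

/-- Polar coordinates for a power of a coordinate against a Gaussian weight. -/
theorem integral_pow_mul_exp_neg_norm_sq (k : ℕ) :
    ∫ x : E3, (x 2 : ℝ) ^ k * Real.exp (-‖x‖ ^ 2) =
      (∫ x : S2, (x.1 2 : ℝ) ^ k ∂surface) * ∫ r in Ioi (0 : ℝ), r ^ (k + 2) * Real.exp (-r ^ 2) := by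
  have hdim : Module.finrank ℝ E3 - 1 = 2 := by simp
  calc
    _ = ∫ x : ({(0)}ᶜ : Set E3), (x.1 2 : ℝ) ^ k * Real.exp (-‖x.1‖ ^ 2)
        ∂((volume : Measure E3).comap Subtype.val) := by
      rw [integral_subtype_comap (measurableSet_singleton _).compl
        fun x : E3 => (x 2 : ℝ) ^ k * Real.exp (-‖x‖ ^ 2), restrict_compl_singleton]
    _ = ∫ y, (y.1.1 2 : ℝ) ^ k * ((y.2 : ℝ) ^ k * Real.exp (-(y.2 : ℝ) ^ 2))
          ∂surface.prod (.volumeIoiPow (Module.finrank ℝ E3 - 1)) := by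
      rw [← (volume : Measure E3).measurePreserving_homeomorphUnitSphereProd.integral_comp
        (Homeomorph.measurableEmbedding _)]
      refine integral_congr_ae (Filter.Eventually.of_forall fun x => ?_)
      have hx : ‖x.1‖ ≠ 0 := norm_ne_zero_iff.2 x.2
      simp only [homeomorphUnitSphereProd_apply_fst_coe, homeomorphUnitSphereProd_apply_snd_coe,
        PiLp.smul_apply, smul_eq_mul]
      rw [← mul_assoc, ← mul_pow]
      congr 2
      field_simp
    _ = (∫ x : S2, (x.1 2 : ℝ) ^ k ∂surface) * ∫ r : Ioi (0 : ℝ), (r : ℝ) ^ k *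
          Real.exp (-(r : ℝ) ^ 2) ∂(.volumeIoiPow (Module.finrank ℝ E3 - 1)) :=
      integral_prod_mul (fun x : S2 => (x.1 2 : ℝ) ^ k)
        (fun r : Ioi (0 : ℝ) => (r : ℝ) ^ k * Real.exp (-(r : ℝ) ^ 2))
    _ = _ := by
      rw [hdim]
      congr 1
      simp only [Measure.volumeIoiPow, ENNReal.ofReal]
      rw [integral_withDensity_eq_integral_smul,
        integral_subtype_comap measurableSet_Ioi fun a : ℝ =>
          Real.toNNReal (a ^ 2) • (a ^ k * Real.exp (-a ^ 2))]
      · refine setIntegral_congr_fun measurableSet_Ioi fun x hx => ?_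
        simp only [NNReal.smul_def, Real.coe_toNNReal _ (sq_nonneg x), smul_eq_mul]
        ring
      · exact (measurable_subtype_coe.pow_const _).real_toNNReal

/-- The Gaussian-weighted moment over `E3` is computed twice, as a product of line integrals and in
polar coordinates. The Gamma factors cancel by `Γ (s + 1) = s Γ s`. -/
theorem integral_coord_pow_even (k : ℕ) (hk : Even k) :
    ∫ x : S2, (x.1 2 : ℝ) ^ k ∂surface = 4 * Real.pi / (k + 1) := by
  have h1 : ∫ x : E3, (x 2 : ℝ) ^ k * Real.exp (-‖x‖ ^ 2) =
      Real.pi * Real.Gamma ((k + 1) / 2) := by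
    have hline : ∀ j : ℕ, Even j → ∫ t : ℝ, t ^ j * Real.exp (-t ^ 2) =
        Real.Gamma ((j + 1) / 2) := by
      intro j hj
      have h := integral_comp_abs (f := fun t => t ^ j * Real.exp (-t ^ 2))
      simp only [hj.pow_abs, sq_abs] at h
      rw [h, integral_pow_mul_exp_neg_sq]
      ring
    let f : Fin 3 → ℝ → ℝ := ![fun t => Real.exp (-t ^ 2), fun t => Real.exp (-t ^ 2),
      fun t => t ^ k * Real.exp (-t ^ 2)]
    have h := integral_fintype_prod_volume_eq_prod f
    rw [← (PiLp.volume_preserving_ofLp (Fin 3)).integral_comp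
      (MeasurableEquiv.toLp 2 (Fin 3 → ℝ)).symm.measurableEmbedding] at h
    have h0 : ∫ t : ℝ, Real.exp (-t ^ 2) = √Real.pi := by
      simpa using integral_gaussian 1
    simp only [f, Fin.prod_univ_three, Matrix.cons_val_zero, Matrix.cons_val_one,
      Matrix.cons_val, hline k hk, h0, Real.mul_self_sqrt Real.pi_pos.le] at h
    rw [← h]
    refine integral_congr_ae (Filter.Eventually.of_forall fun x => ?_)
    simp only [EuclideanSpace.norm_sq_eq, Fin.sum_univ_three, Real.norm_eq_abs, sq_abs, neg_add,
      Real.exp_add]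
    ring
  have h2 := integral_pow_mul_exp_neg_norm_sq k
  rw [h1, integral_pow_mul_exp_neg_sq] at h2
  have h3 : Real.Gamma (((k + 2 : ℕ) + 1) / 2) = (k + 1) / 2 * Real.Gamma ((k + 1) / 2) := by
    rw [← Real.Gamma_add_one (by positivity)]
    congr 1; push_cast; ring
  have h4 : Real.Gamma (((k : ℝ) + 1) / 2) ≠ 0 := (Real.Gamma_pos_of_pos (by positivity)).ne'
  rw [h3] at h2
  have h5 : (k : ℝ) + 1 ≠ 0 := by positivity
  rw [eq_div_iff h5]
  apply mul_right_cancel₀ h4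
  linarith

theorem integral_coord_pow_odd (k : ℕ) (hk : Odd k) :
    ∫ x : S2, (x.1 2 : ℝ) ^ k ∂surface = 0 := by
  have h := integral_comp_rotate (LinearIsometryEquiv.neg ℝ) (f := fun x : S2 => (x.1 2 : ℝ) ^ k)
    (by fun_prop)
  simp only [rotate, LinearIsometryEquiv.coe_neg, PiLp.neg_apply, hk.neg_pow, integral_neg] at h
  linarith

/-- The functional `p ↦ (2π)⁻¹ ∫ p(z)` on polynomials, `z` being the height on the sphere. -/
def heightIntegral : ℝ[X] →ₗ[ℝ] ℝ where
  toFun p := (2 * Real.pi)⁻¹ * ∫ x : S2, p.eval (x.1 2) ∂surface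
  map_add' p q := by
    simp only [eval_add]
    rw [integral_add (integrable_of_continuous (by fun_prop))
      (integrable_of_continuous (by fun_prop)), mul_add]
  map_smul' c p := by
    simp only [eval_smul, smul_eq_mul, RingHom.id_apply]
    rw [integral_const_mul]
    ring

theorem integral_eval_height (p : ℝ[X]) :
    ∫ x : S2, p.eval (x.1 2) ∂surface = 2 * Real.pi * heightIntegral p := by
  simp only [heightIntegral, LinearMap.coe_mk, AddHom.coe_mk]
  field_simp

/-- Archimedes: the height is uniformly distributed over `[-1, 1]`. -/
theorem isInterval_heightIntegral : IsInterval heightIntegral := by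
  intro p
  induction p using Polynomial.induction_on' with
  | add p q hp hq => simp only [map_add, hp, hq, eval_add]; ring
  | monomial n a =>
    cases n with
    | zero => simp
    | succ k =>
      have h : derivative (monomial (k + 1) a) = (a * (k + 1)) • (X ^ k : ℝ[X]) := by
        rw [derivative_monomial, smul_X_eq_monomial]; simp
      rw [h, map_smul]
      simp only [heightIntegral, LinearMap.coe_mk, AddHom.coe_mk, eval_pow, eval_X,
        eval_monomial, smul_eq_mul]
      have hk : (k : ℝ) + 1 ≠ 0 := by positivity
      rcases Nat.even_or_odd k with he | ho
      · rw [integral_coord_pow_even k he, he.add_one.neg_pow]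
        field_simp
        norm_num
        ring
      · rw [integral_coord_pow_odd k ho, ho.add_one.neg_pow]
        simp

/-- Rotation about the vertical axis. -/
def axialRotation (t : ℝ) : E3 ≃ₗᵢ[ℝ] E3 :=
  LinearIsometry.toLinearIsometryEquiv
    { toFun := fun x => !₂[Real.cos t * x 0 - Real.sin t * x 1,
        Real.sin t * x 0 + Real.cos t * x 1, x 2]
      map_add' := fun x y => by ext i; fin_cases i <;> simp <;> ring
      map_smul' := fun c x => by ext i; fin_cases i <;> simp <;> ring
      norm_map' := fun x => by
        simp only [LinearMap.coe_mk, AddHom.coe_mk]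
        rw [EuclideanSpace.norm_eq, EuclideanSpace.norm_eq]
        congr 1
        simp only [Fin.sum_univ_three, Real.norm_eq_abs, sq_abs, Matrix.cons_val_zero,
          Matrix.cons_val_one, Matrix.cons_val]
        linear_combination (x 0 ^ 2 + x 1 ^ 2) * Real.sin_sq_add_cos_sq t } rfl

/-- The complex coordinate `x + i y` on the sphere. -/
def horiz (x : S2) : ℂ := (x.1 0 : ℂ) + (x.1 1 : ℂ) * Complex.I

@[fun_prop]
theorem continuous_horiz : Continuous horiz := by
  unfold horiz
  fun_prop

theorem horiz_rotate (t : ℝ) (x : S2) :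
    horiz (rotate (axialRotation t) x) = Complex.exp (t * Complex.I) * horiz x := by
  rw [Complex.exp_mul_I]
  simp only [horiz, rotate, axialRotation, LinearIsometry.coe_toLinearIsometryEquiv,
    LinearIsometry.coe_mk, LinearMap.coe_mk, AddHom.coe_mk, Matrix.cons_val_zero,
    Matrix.cons_val_one]
  push_cast
  linear_combination (-Complex.sin t * x.1 1) * Complex.I_sq

theorem height_rotate (t : ℝ) (x : S2) : (rotate (axialRotation t) x).1 2 = x.1 2 := by
  simp [rotate, axialRotation]

theorem horiz_mul_conj (x : S2) :
    horiz x * (starRingEnd ℂ) (horiz x) = ((1 - x.1 2 ^ 2 : ℝ) : ℂ) := by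
  have h : ‖x.1‖ ^ 2 = 1 := by simp
  rw [EuclideanSpace.norm_sq_eq, Fin.sum_univ_three] at h
  simp only [Real.norm_eq_abs, sq_abs] at h
  rw [Complex.mul_conj, Complex.normSq_apply]
  simp only [horiz]
  congr 1
  simp
  linarith

/-- The rotation by the angle `π / (m - n)` about the axis preserves the measure and changes the
sign of the integrand. -/
theorem integral_horiz_eq_zero {m n : ℕ} (hmn : m ≠ n) {f : ℝ → ℂ} (hf : Continuous f) :
    ∫ x : S2, horiz x ^ m * (starRingEnd ℂ) (horiz x) ^ n * f (x.1 2) ∂surface = 0 := by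
  set k : ℝ := (m : ℝ) - n with hk
  have hk0 : k ≠ 0 := sub_ne_zero.2 (by exact_mod_cast hmn)
  have h := integral_comp_rotate (axialRotation (Real.pi / k))
    (f := fun x : S2 => horiz x ^ m * (starRingEnd ℂ) (horiz x) ^ n * f (x.1 2))
    (by have := Complex.continuous_conj; fun_prop)
  have hphase : Complex.exp ((Real.pi / k : ℝ) * Complex.I) ^ m *
      (starRingEnd ℂ) (Complex.exp ((Real.pi / k : ℝ) * Complex.I)) ^ n = -1 := by
    rw [← Complex.exp_conj, ← Complex.exp_nat_mul, ← Complex.exp_nat_mul, ← Complex.exp_add,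
      ← Complex.exp_pi_mul_I]
    congr 1
    simp only [map_mul, Complex.conj_ofReal, Complex.conj_I]
    have : (k : ℂ) ≠ 0 := by exact_mod_cast hk0
    push_cast
    field_simp
    rw [hk]
    push_cast
    ring
  have h2 : ∀ x : S2, horiz (rotate (axialRotation (Real.pi / k)) x) ^ m *
      (starRingEnd ℂ) (horiz (rotate (axialRotation (Real.pi / k)) x)) ^ n *
        f ((rotate (axialRotation (Real.pi / k)) x).1 2) =
      -(horiz x ^ m * (starRingEnd ℂ) (horiz x) ^ n * f (x.1 2)) := by
    intro x
    rw [horiz_rotate, height_rotate, map_mul, mul_pow, mul_pow]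
    linear_combination (horiz x ^ m * (starRingEnd ℂ) (horiz x) ^ n * f (x.1 2)) * hphase
  simp only [h2, integral_neg] at h
  exact self_eq_neg.1 h.symm

end SurfaceMeasure

/-! ### Orthonormality of the spherical harmonics -/

section Harmonics

open Polynomial ComplexConjugate

/-- The derivative of order `m` of the Legendre polynomial of degree `l`. -/
def assocPoly (l m : ℕ) : ℝ[X] := derivative^[m] (legendreP l)

/-- The power of `x + i y` or of its conjugate that carries the dependence on the longitude. -/
def azim (m : ℤ) (x : S2) : ℂ := horiz x ^ m.toNat * conj (horiz x) ^ (-m).toNat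

/-- The normalization of the spherical harmonics, with its sign. -/
def harmConst (l : ℕ) (m : ℤ) : ℝ :=
  (if 0 ≤ m then (-1) ^ m.natAbs else 1) *
    √((2 * l + 1) / (4 * Real.pi) * (((l - m.natAbs)! : ℝ) / ((l + m.natAbs)! : ℝ)))

theorem harmConst_sq (l : ℕ) (m : ℤ) : harmConst l m ^ 2 =
    (2 * l + 1) / (4 * Real.pi) * (((l - m.natAbs)! : ℝ) / ((l + m.natAbs)! : ℝ)) := by
  have h : 0 < Real.pi := Real.pi_pos
  rw [harmConst, mul_pow, Real.sq_sqrt (by positivity)]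
  split_ifs
  · rw [← pow_mul, mul_comm m.natAbs, pow_mul]; simp
  · simp

theorem harmConst_ne_zero (l : ℕ) (m : ℤ) : harmConst l m ≠ 0 := by
  have h : 0 < Real.pi := Real.pi_pos
  refine (pow_ne_zero_iff two_ne_zero).1 ?_
  rw [harmConst_sq]
  positivity

/-- One formula for both signs of `m`. For `m < 0` the sign in `sphHarm` cancels the one in
`sphHarmNonneg`, so `harmConst` carries a sign only for `m ≥ 0`. -/
theorem sphHarm_eq (l : ℕ) (m : ℤ) (x : S2) :
    sphHarm l m x = harmConst l m * azim m x * ((assocPoly l m.natAbs).eval (x.1 2) : ℝ) := by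
  unfold sphHarm sphHarmNonneg harmConst azim assocPoly
  by_cases hm : 0 ≤ m
  · have h1 : m.toNat = m.natAbs := by omega
    have h2 : (-m).toNat = 0 := by omega
    simp only [hm, if_true, h1, h2, horiz]
    push_cast
    ring
  · have h1 : m.toNat = 0 := by omega
    have h2 : (-m).toNat = m.natAbs := by omega
    simp only [hm, if_false, h1, h2, map_mul, map_pow, Complex.conj_ofReal, map_neg, map_one]
    have h3 : ((-1 : ℂ) ^ m.natAbs) * (-1) ^ m.natAbs = 1 := by rw [← mul_pow]; simp
    rw [← mul_assoc, ← mul_assoc, ← mul_assoc, h3]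
    simp only [horiz]
    push_cast
    ring

theorem conj_azim (m : ℤ) (x : S2) : conj (azim m x) = azim (-m) x := by
  simp only [azim, map_mul, map_pow, Complex.conj_conj, neg_neg]
  ring

theorem conj_sphHarm (l : ℕ) (m : ℤ) (x : S2) :
    conj (sphHarm l m x) = (-1) ^ m.natAbs * sphHarm l (-m) x := by
  have h3 : ((-1 : ℂ) ^ m.natAbs) * (-1) ^ m.natAbs = 1 := by rw [← mul_pow]; simp
  rw [sphHarm_eq, sphHarm_eq, map_mul, map_mul, conj_azim, Complex.conj_ofReal,
    Complex.conj_ofReal, Int.natAbs_neg, harmConst, harmConst, Int.natAbs_neg]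
  rcases lt_trichotomy m 0 with hm | rfl | hm
  · rw [if_neg (by omega), if_pos (by omega)]
    push_cast
    rw [← mul_assoc, ← mul_assoc, ← mul_assoc, h3]
  · simp
  · rw [if_pos (by omega), if_neg (by omega)]
    push_cast
    ring

theorem azim_mul_conj_self (m : ℤ) (x : S2) :
    azim m x * conj (azim m x) = ((1 - x.1 2 ^ 2 : ℝ) : ℂ) ^ m.natAbs := by
  rw [← horiz_mul_conj, conj_azim, azim, azim, neg_neg, mul_pow]
  have h : m.natAbs = m.toNat + (-m).toNat := by omega
  rw [h]
  ring

/-- For `m = k` the azimuthal factors multiply to `(1 - z ^ 2) ^ |m|`, leaving a polynomial in the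
height. For `m ≠ k` the exponents of `horiz` and its conjugate differ by `m - k`, and
`integral_horiz_eq_zero` applies. -/
theorem integral_sphHarm_mul_conj {l n : ℕ} {m k : ℤ} (hm : m.natAbs ≤ l) (hk : k.natAbs ≤ n) :
    ∫ x, sphHarm l m x * conj (sphHarm n k x) ∂surface = if l = n ∧ m = k then 1 else 0 := by
  have hform : ∀ x, sphHarm l m x * conj (sphHarm n k x) =
      ((harmConst l m * harmConst n k : ℝ) : ℂ) * (azim m x * conj (azim k x) *
        (((assocPoly l m.natAbs * assocPoly n k.natAbs).eval (x.1 2) : ℝ) : ℂ)) := by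
    intro x
    rw [sphHarm_eq, sphHarm_eq, map_mul, map_mul, Complex.conj_ofReal, Complex.conj_ofReal,
      eval_mul]
    push_cast
    ring
  simp only [hform, integral_const_mul]
  by_cases hmk : m = k
  · subst hmk
    have h1 : ∀ x : S2, azim m x * conj (azim m x) *
        (((assocPoly l m.natAbs * assocPoly n m.natAbs).eval (x.1 2) : ℝ) : ℂ) =
        ((((1 - X ^ 2) ^ m.natAbs * assocPoly l m.natAbs * assocPoly n m.natAbs).eval
          (x.1 2) : ℝ) : ℂ) := by
      intro x
      rw [azim_mul_conj_self]
      simp only [eval_mul, eval_pow, eval_sub, eval_one, eval_X]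
      push_cast
      ring
    simp only [h1]
    rw [integral_complex_ofReal, integral_eval_height]
    simp only [and_true]
    have hval : heightIntegral ((1 - X ^ 2) ^ m.natAbs * assocPoly l m.natAbs *
        assocPoly n m.natAbs) = if l = n then
          2 / (2 * (l : ℝ) + 1) * (((l + m.natAbs)! : ℝ) / ((l - m.natAbs)! : ℝ)) else 0 := by
      -- `IsInterval.assoc_legendre` assumes ordered degrees; the other order follows by exchanging
      -- the factors.
      rcases le_total l n with h | h
      · exact isInterval_heightIntegral.assoc_legendre hm h
      · have := isInterval_heightIntegral.assoc_legendre hk h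
        rw [mul_right_comm]
        simp only [assocPoly]
        rw [this]
        by_cases hln : l = n
        · subst hln; simp
        · rw [if_neg hln, if_neg (Ne.symm hln)]
    rw [hval]
    split_ifs with h
    · subst h
      rw [← Complex.ofReal_mul, ← sq, harmConst_sq, ← Complex.ofReal_one]
      congr 1
      have h1 : (2 * (l : ℝ) + 1) ≠ 0 := by positivity
      have h2 := Real.pi_ne_zero
      field_simp
      norm_num
    · simp
  · rw [if_neg (by tauto)]
    have h1 : ∀ x : S2, azim m x * conj (azim k x) *
        (((assocPoly l m.natAbs * assocPoly n k.natAbs).eval (x.1 2) : ℝ) : ℂ) =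
        horiz x ^ (m.toNat + (-k).toNat) * conj (horiz x) ^ ((-m).toNat + k.toNat) *
        (((assocPoly l m.natAbs * assocPoly n k.natAbs).eval (x.1 2) : ℝ) : ℂ) := by
      intro x
      rw [conj_azim, azim, azim, neg_neg]
      ring
    simp only [h1]
    rw [integral_horiz_eq_zero (f := fun z : ℝ =>
      (((assocPoly l m.natAbs * assocPoly n k.natAbs).eval z : ℝ) : ℂ)) (by omega)
      (by fun_prop), mul_zero]

/-- Real and imaginary parts also require the product without conjugation. -/
theorem integral_sphHarm_mul {l n : ℕ} {m k : ℤ} (hm : m.natAbs ≤ l) (hk : k.natAbs ≤ n) :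
    ∫ x, sphHarm l m x * sphHarm n k x ∂surface =
      if l = n ∧ m = -k then (-1) ^ k.natAbs else 0 := by
  have h : ∀ x, sphHarm l m x * sphHarm n k x =
      (-1) ^ k.natAbs * (sphHarm l m x * conj (sphHarm n (-k) x)) := by
    intro x
    have h3 : ((-1 : ℂ) ^ k.natAbs) * (-1) ^ k.natAbs = 1 := by rw [← mul_pow]; simp
    rw [conj_sphHarm, Int.natAbs_neg, neg_neg]
    linear_combination (-(sphHarm l m x * sphHarm n k x)) * h3
  simp only [h, integral_const_mul]
  rw [integral_sphHarm_mul_conj hm (by rwa [Int.natAbs_neg])]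
  simp

theorem orthonormal_complexDict : Orthonormal ℂ complexDict := by
  rw [orthonormal_iff_ite]
  rintro ⟨l, m, hm⟩ ⟨n, k, hk⟩
  rw [complexDict, complexDict, ContinuousMap.inner_toLp]
  simp only [ContinuousMap.coe_mk]
  rw [integral_sphHarm_mul_conj hk hm]
  refine if_congr ?_ rfl rfl
  constructor
  · rintro ⟨rfl, rfl⟩; rfl
  · intro h
    simp only [Sigma.mk.injEq] at h
    obtain ⟨rfl, h2⟩ := h
    simp only [heq_eq_eq, Subtype.mk.injEq] at h2
    exact ⟨rfl, h2.symm⟩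

section RealParts

variable {l n : ℕ} {m k : ℤ}

theorem integrable_sphHarm_mul : Integrable (fun x => sphHarm l m x * sphHarm n k x) surface :=
  integrable_of_continuous ((continuous_sphHarm l m).mul (continuous_sphHarm n k))

theorem integrable_sphHarm_mul_conj :
    Integrable (fun x => sphHarm l m x * conj (sphHarm n k x)) surface :=
  integrable_of_continuous ((continuous_sphHarm l m).mul
    (Complex.continuous_conj.comp (continuous_sphHarm n k)))

theorem integrable_re {f : S2 → ℂ} (hf : Integrable f surface) :
    Integrable (fun x => (f x).re) surface := hf.re

theorem integrable_im {f : S2 → ℂ} (hf : Integrable f surface) :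
    Integrable (fun x => (f x).im) surface := hf.im

/-- From `2 Re a Re b = Re (a b) + Re (a conj b)`; the two statements that follow are analogous. -/
theorem integral_re_mul_re : ∫ x, (sphHarm l m x).re * (sphHarm n k x).re ∂surface =
    ((∫ x, sphHarm l m x * sphHarm n k x ∂surface).re +
      (∫ x, sphHarm l m x * conj (sphHarm n k x) ∂surface).re) / 2 := by
  have h1 := integral_re (integrable_sphHarm_mul (l := l) (n := n) (m := m) (k := k))
  have h2 := integral_re (integrable_sphHarm_mul_conj (l := l) (n := n) (m := m) (k := k))
  simp only [RCLike.re_eq_complex_re] at h1 h2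
  rw [← h1, ← h2, ← integral_add (integrable_re integrable_sphHarm_mul) (integrable_re integrable_sphHarm_mul_conj),
    ← integral_div]
  refine integral_congr_ae (Filter.Eventually.of_forall fun x => ?_)
  simp

theorem integral_im_mul_im : ∫ x, (sphHarm l m x).im * (sphHarm n k x).im ∂surface =
    ((∫ x, sphHarm l m x * conj (sphHarm n k x) ∂surface).re -
      (∫ x, sphHarm l m x * sphHarm n k x ∂surface).re) / 2 := by
  have h1 := integral_re (integrable_sphHarm_mul (l := l) (n := n) (m := m) (k := k))
  have h2 := integral_re (integrable_sphHarm_mul_conj (l := l) (n := n) (m := m) (k := k))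
  simp only [RCLike.re_eq_complex_re] at h1 h2
  rw [← h1, ← h2, ← integral_sub (integrable_re integrable_sphHarm_mul_conj) (integrable_re integrable_sphHarm_mul),
    ← integral_div]
  refine integral_congr_ae (Filter.Eventually.of_forall fun x => ?_)
  simp

theorem integral_re_mul_im : ∫ x, (sphHarm l m x).re * (sphHarm n k x).im ∂surface =
    ((∫ x, sphHarm l m x * sphHarm n k x ∂surface).im -
      (∫ x, sphHarm l m x * conj (sphHarm n k x) ∂surface).im) / 2 := by
  have h1 := integral_im (integrable_sphHarm_mul (l := l) (n := n) (m := m) (k := k))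
  have h2 := integral_im (integrable_sphHarm_mul_conj (l := l) (n := n) (m := m) (k := k))
  simp only [RCLike.im_eq_complex_im] at h1 h2
  rw [← h1, ← h2, ← integral_sub (integrable_im integrable_sphHarm_mul) (integrable_im integrable_sphHarm_mul_conj),
    ← integral_div]
  refine integral_congr_ae (Filter.Eventually.of_forall fun x => ?_)
  simp

/-- Products of real and imaginary parts integrate to zero. -/
theorem integral_re_mul_im_eq_zero (hm : m.natAbs ≤ l) (hk : k.natAbs ≤ n) :
    ∫ x, (sphHarm l m x).re * (sphHarm n k x).im ∂surface = 0 := by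
  have h : (((-1 : ℂ)) ^ k.natAbs).im = 0 := by
    rcases neg_one_pow_eq_or ℂ k.natAbs with h | h <;> simp [h]
  rw [integral_re_mul_im, integral_sphHarm_mul hm hk, integral_sphHarm_mul_conj hm hk]
  split_ifs <;> simp [h]

/-- Only nonnegative orders enter `realSphHarm`, so the unconjugated product contributes only when
both orders are zero. Otherwise the two factors `√2` compensate the `1 / 2` of the product formulas.
-/
theorem integral_realSphHarm_mul (hm : m.natAbs ≤ l) (hk : k.natAbs ≤ n) :
    ∫ x, realSphHarm l m x * realSphHarm n k x ∂surface = if l = n ∧ m = k then 1 else 0 := by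
  have h2 : √2 * √2 = (2 : ℝ) := Real.mul_self_sqrt zero_le_two
  have hm' : (-m).natAbs ≤ l := by rwa [Int.natAbs_neg]
  have hk' : (-k).natAbs ≤ n := by rwa [Int.natAbs_neg]
  unfold realSphHarm
  rcases lt_trichotomy m 0 with hm0 | rfl | hm0 <;> rcases lt_trichotomy k 0 with hk0 | rfl | hk0
  · simp only [hm0.ne, hk0.ne, hm0.not_gt, hk0.not_gt, if_false]
    simp only [mul_mul_mul_comm, h2, integral_const_mul]
    rw [integral_im_mul_im, integral_sphHarm_mul hm' hk', integral_sphHarm_mul_conj hm' hk',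
      if_neg (show ¬(l = n ∧ -m = - -k) by omega)]
    by_cases h : l = n ∧ m = k
    · rw [if_pos h, if_pos (by omega)]; simp
    · rw [if_neg h, if_neg (by omega)]; simp
  · simp only [hm0.ne, hm0.not_gt, if_false, if_true]
    simp only [mul_comm _ (sphHarm n 0 _).re, mul_left_comm _ (√2), integral_const_mul]
    rw [integral_re_mul_im_eq_zero hk hm', if_neg (by simp), mul_zero]
  · simp only [hm0.ne, hm0.not_gt, hk0.ne', hk0, if_false, if_true]
    simp only [mul_mul_mul_comm, mul_comm (sphHarm l (-m) _).im, h2, integral_const_mul]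
    rw [integral_re_mul_im_eq_zero hk hm', if_neg (by omega), mul_zero]
  · simp only [hk0.ne, hk0.not_gt, if_false, if_true]
    simp only [mul_left_comm _ (√2), integral_const_mul]
    rw [integral_re_mul_im_eq_zero hm hk', if_neg (by omega), mul_zero]
  · simp only [if_true]
    rw [integral_re_mul_re, integral_sphHarm_mul hm hk, integral_sphHarm_mul_conj hm hk]
    by_cases h : l = n
    · simp [h]
    · simp [h]
  · simp only [hk0.ne', hk0, if_false, if_true]
    simp only [mul_left_comm _ (√2), integral_const_mul]
    rw [integral_re_mul_re, integral_sphHarm_mul hm hk, integral_sphHarm_mul_conj hm hk,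
      if_neg (by omega), if_neg (by omega)]
    simp [hk0.ne]
  · simp only [hk0.ne, hk0.not_gt, hm0.ne', hm0, if_false, if_true]
    simp only [mul_mul_mul_comm, h2, integral_const_mul]
    rw [integral_re_mul_im_eq_zero hm hk', if_neg (by omega), mul_zero]
  · simp only [hm0.ne', hm0, if_false, if_true]
    simp only [mul_assoc, integral_const_mul]
    rw [integral_re_mul_re, integral_sphHarm_mul hm hk, integral_sphHarm_mul_conj hm hk,
      if_neg (by omega), if_neg (by omega)]
    simp
  · simp only [hm0.ne', hk0.ne', hm0, hk0, if_false, if_true]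
    simp only [mul_mul_mul_comm, h2, integral_const_mul]
    rw [integral_re_mul_re, integral_sphHarm_mul hm hk, integral_sphHarm_mul_conj hm hk,
      if_neg (show ¬(l = n ∧ m = -k) by omega)]
    split_ifs <;> simp

end RealParts

theorem orthonormal_realDict : Orthonormal ℝ realDict := by
  rw [orthonormal_iff_ite]
  rintro ⟨l, m, hm⟩ ⟨n, k, hk⟩
  rw [realDict, realDict, ContinuousMap.inner_toLp]
  simp only [ContinuousMap.coe_mk, conj_trivial]
  rw [integral_realSphHarm_mul hk hm]
  refine if_congr ?_ rfl rfl
  constructor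
  · rintro ⟨rfl, rfl⟩; rfl
  · intro h
    simp only [Sigma.mk.injEq] at h
    obtain ⟨rfl, h2⟩ := h
    simp only [heq_eq_eq, Subtype.mk.injEq] at h2
    exact ⟨rfl, h2.symm⟩

end Harmonics

/-! ### Completeness of both dictionaries -/

section Completeness

open Polynomial ComplexConjugate

/-- The continuous functions `u ^ a * conj u ^ b * q z` on the sphere, with `u = x + i y`. -/
def sphMonomial (a b : ℕ) (q : ℝ[X]) : C(S2, ℂ) where
  toFun x := horiz x ^ a * conj (horiz x) ^ b * ((q.eval (x.1 2) : ℝ) : ℂ)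
  continuous_toFun := by
    have := Complex.continuous_conj
    fun_prop

theorem sphMonomial_apply (a b : ℕ) (q : ℝ[X]) (x : S2) :
    sphMonomial a b q x = horiz x ^ a * conj (horiz x) ^ b * ((q.eval (x.1 2) : ℝ) : ℂ) := rfl

/-- The spherical harmonics as continuous functions. -/
def sphHarmC (i : HarmIndex) : C(S2, ℂ) := ⟨sphHarm i.1 i.2.1, continuous_sphHarm i.1 i.2.1⟩

/-- The degree must be exact: one polynomial of each degree spans `ℝ[X]`, whence `span_assocPoly`.
-/
theorem assocPoly_degree (m k : ℕ) : (assocPoly (m + k) m).degree = k := by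
  have h1 : (assocPoly (m + k) m).natDegree ≤ k :=
    (natDegree_iterate_derivative _ _).trans
      ((Nat.sub_le_sub_right (natDegree_legendreP_le _) m).trans (by omega))
  have h2 : (assocPoly (m + k) m).coeff k ≠ 0 := by
    rw [assocPoly, coeff_iterate_derivative, add_comm k m, coeff_legendreP, nsmul_eq_mul]
    have : 0 < (m + k).descFactorial m := Nat.descFactorial_pos.2 (by omega)
    positivity
  exact le_antisymm (natDegree_le_iff_degree_le.1 h1) (le_degree_of_ne_zero h2)

/-- The derivatives of order `m` of the Legendre polynomials of degree at least `m`. -/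
def assocSequence (m : ℕ) : Polynomial.Sequence ℝ where
  elems' k := assocPoly (m + k) m
  degree_eq' := assocPoly_degree m

theorem span_assocPoly (m : ℕ) :
    Submodule.span ℝ (Set.range fun k => assocPoly (m + k) m) = ⊤ :=
  (assocSequence m).span fun i => ((leadingCoeff_ne_zero).2 ((assocSequence m).ne_zero i)).isUnit

/-- Expand `q` in the polynomials `assocPoly (|m| + k) |m|`; each term is a multiple of the harmonic
of degree `|m| + k` and order `m`. -/
theorem azim_mul_mem_span (m : ℤ) (q : ℝ[X]) :
    sphMonomial m.toNat (-m).toNat q ∈ Submodule.span ℂ (Set.range sphHarmC) := by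
  have hq : q ∈ Submodule.span ℝ (Set.range fun k => assocPoly (m.natAbs + k) m.natAbs) := by
    rw [span_assocPoly]; trivial
  induction hq using Submodule.span_induction with
  | mem p hp =>
    obtain ⟨k, rfl⟩ := hp
    have h : sphMonomial m.toNat (-m).toNat (assocPoly (m.natAbs + k) m.natAbs) =
        ((harmConst (m.natAbs + k) m : ℂ))⁻¹ •
          sphHarmC ⟨m.natAbs + k, m, Nat.le_add_right _ _⟩ := by
      ext x
      have h0 : (harmConst (m.natAbs + k) m : ℂ) ≠ 0 := by
        exact_mod_cast harmConst_ne_zero _ _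
      simp only [ContinuousMap.smul_apply, smul_eq_mul, sphHarmC, ContinuousMap.coe_mk,
        sphHarm_eq, sphMonomial_apply, azim]
      field_simp
    rw [h]
    exact Submodule.smul_mem _ _ (Submodule.subset_span ⟨_, rfl⟩)
  | zero =>
    convert! Submodule.zero_mem _ using 1
    ext x
    simp [sphMonomial_apply]
  | add p r _ _ hp hr =>
    convert! Submodule.add_mem _ hp hr using 1
    ext x
    simp [sphMonomial_apply, mul_add]
  | smul c p _ hp =>
    convert! Submodule.smul_mem _ (c : ℂ) hp using 1
    ext x
    simp [sphMonomial_apply]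
    ring

/-- The common `min a b` factors `u * conj u = 1 - z ^ 2` are absorbed into `q`, leaving a pure
power of `u` or of `conj u`. -/
theorem sphMonomial_mem_span (a b : ℕ) (q : ℝ[X]) :
    sphMonomial a b q ∈ Submodule.span ℂ (Set.range sphHarmC) := by
  have h : sphMonomial a b q = sphMonomial ((a : ℤ) - b).toNat (-((a : ℤ) - b)).toNat
      ((1 - X ^ 2) ^ (min a b) * q) := by
    ext x
    obtain ⟨c, hc⟩ : ∃ c, c = min a b := ⟨_, rfl⟩
    have ha : a = ((a : ℤ) - b).toNat + c := by omega
    have hb : b = (-((a : ℤ) - b)).toNat + c := by omega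
    rw [← hc]
    generalize ((a : ℤ) - b).toNat = a' at *
    generalize (-((a : ℤ) - b)).toNat = b' at *
    rw [ha, hb, sphMonomial_apply, sphMonomial_apply, pow_add, pow_add, mul_mul_mul_comm,
      ← mul_pow, horiz_mul_conj]
    simp only [eval_mul, eval_pow, eval_sub, eval_one, eval_X]
    push_cast
    ring
  rw [h]
  exact azim_mul_mem_span _ _

/-- The set of the functions `u ^ a * conj u ^ b * q z`, a monoid. -/
def sphMonomials : Submonoid C(S2, ℂ) where
  carrier := {f | ∃ a b q, f = sphMonomial a b q}
  one_mem' := ⟨0, 0, 1, by ext x; simp [sphMonomial_apply]⟩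
  mul_mem' := by
    rintro _ _ ⟨a, b, q, rfl⟩ ⟨a', b', q', rfl⟩
    refine ⟨a + a', b + b', q * q', ?_⟩
    ext x
    simp only [ContinuousMap.mul_apply, sphMonomial_apply, eval_mul]
    push_cast
    ring

theorem adjoin_sphMonomials_eq_span :
    Subalgebra.toSubmodule (Algebra.adjoin ℂ (sphMonomials : Set C(S2, ℂ))) =
      Submodule.span ℂ (sphMonomials : Set C(S2, ℂ)) := by
  rw [Algebra.adjoin_eq_span, Submonoid.closure_eq]

/-- The algebra of polynomial functions on the sphere. -/
def polyAlgebra : StarSubalgebra ℂ C(S2, ℂ) where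
  __ := Algebra.adjoin ℂ (sphMonomials : Set C(S2, ℂ))
  star_mem' := by
    intro f hf
    change f ∈ Subalgebra.toSubmodule (Algebra.adjoin ℂ (sphMonomials : Set C(S2, ℂ))) at hf
    change star f ∈ Subalgebra.toSubmodule (Algebra.adjoin ℂ (sphMonomials : Set C(S2, ℂ)))
    rw [adjoin_sphMonomials_eq_span] at hf ⊢
    induction hf using Submodule.span_induction with
    | mem f hf =>
      obtain ⟨a, b, q, rfl⟩ := hf
      refine Submodule.subset_span ⟨b, a, q, ?_⟩
      ext x
      simp [sphMonomial_apply, mul_comm]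
    | zero => simp
    | add f g _ _ hf hg => rw [star_add]; exact Submodule.add_mem _ hf hg
    | smul c f _ hf => rw [star_smul]; exact Submodule.smul_mem _ _ hf

theorem sphMonomial_mem_polyAlgebra (a b : ℕ) (q : ℝ[X]) : sphMonomial a b q ∈ polyAlgebra :=
  Algebra.subset_adjoin ⟨a, b, q, rfl⟩

theorem polyAlgebra_separatesPoints : polyAlgebra.SeparatesPoints := by
  intro x y hxy
  by_contra! h
  have h1 : horiz x = horiz y := by
    simpa [sphMonomial_apply] using h _ ⟨_, sphMonomial_mem_polyAlgebra 1 0 1, rfl⟩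
  have h2 : x.1 2 = y.1 2 := by
    simpa [sphMonomial_apply] using h _ ⟨_, sphMonomial_mem_polyAlgebra 0 0 X, rfl⟩
  have h3 := congrArg Complex.re h1
  have h4 := congrArg Complex.im h1
  simp [horiz] at h3 h4
  refine hxy (Subtype.ext ?_)
  ext i
  fin_cases i
  exacts [h3, h4, h2]

/-- Stone–Weierstrass for `polyAlgebra`, which lies inside the span of the harmonics. -/
theorem span_sphHarmC_closure_eq_top :
    (Submodule.span ℂ (Set.range sphHarmC)).topologicalClosure = ⊤ := by
  have h := ContinuousMap.starSubalgebra_topologicalClosure_eq_top_of_separatesPoints polyAlgebra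
    polyAlgebra_separatesPoints
  have h1 : (Subalgebra.toSubmodule polyAlgebra.toSubalgebra).topologicalClosure = ⊤ :=
    congr_arg (Subalgebra.toSubmodule <| StarSubalgebra.toSubalgebra ·) h
  refine top_le_iff.1 (h1 ▸ Submodule.topologicalClosure_mono ?_)
  refine adjoin_sphMonomials_eq_span.le.trans (Submodule.span_le.2 ?_)
  rintro _ ⟨a, b, q, rfl⟩
  exact sphMonomial_mem_span a b q

theorem complexDict_complete : (Submodule.span ℂ (Set.range complexDict))ᗮ = ⊥ := by
  rw [← Submodule.topologicalClosure_eq_top_iff]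
  convert! (ContinuousMap.toLp_denseRange ℂ surface ℂ (p := 2)
    ENNReal.ofNat_ne_top).topologicalClosure_map_submodule span_sphHarmC_closure_eq_top
  rw [Submodule.map_span, ← Set.range_comp]
  rfl

/-- The conjugate appears because the inner product conjugates its first argument. For order `n >
0`, the harmonic is the real one of order `n` plus `i` times that of order `-n`, over `√2`. -/
theorem exists_conj_sphHarm_eq (l : ℕ) (m : ℤ) : ∃ α β : ℂ, ∀ x, conj (sphHarm l m x) =
    α * realSphHarm l m.natAbs x + β * realSphHarm l (-(m.natAbs : ℤ)) x := by
  have h2 : ((√2 : ℝ) : ℂ) ≠ 0 := by exact_mod_cast (Real.sqrt_pos.2 two_pos).ne'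
  have key : ∀ n : ℕ, ∃ α β : ℂ, ∀ x, sphHarm l n x =
      α * realSphHarm l n x + β * realSphHarm l (-(n : ℤ)) x := by
    intro n
    rcases Nat.eq_zero_or_pos n with rfl | hn
    · refine ⟨1, 0, fun x => ?_⟩
      have h := conj_sphHarm l 0 x
      simp only [Int.natAbs_zero, pow_zero, neg_zero, one_mul] at h
      simp [realSphHarm, Complex.conj_eq_iff_re.1 h]
    · refine ⟨(√2 : ℝ)⁻¹, (√2 : ℝ)⁻¹ * Complex.I, fun x => ?_⟩
      have h0 : ¬ (n : ℤ) = 0 := by omega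
      have h3 : ¬ -(n : ℤ) = 0 := by omega
      have h4 : (0 : ℤ) < n := by omega
      have h5 : ¬ (0 : ℤ) < -n := by omega
      simp only [realSphHarm, h0, h3, h4, h5, if_true, if_false, neg_neg]
      conv_lhs => rw [← Complex.re_add_im (sphHarm l n x)]
      push_cast
      field_simp
  obtain ⟨α, β, h⟩ := key m.natAbs
  rcases le_total 0 m with hm | hm
  · refine ⟨conj α, conj β, fun x => ?_⟩
    have := h x
    rw [Int.natAbs_of_nonneg hm] at this ⊢
    rw [this]
    simp
  · refine ⟨(-1) ^ m.natAbs * α, (-1) ^ m.natAbs * β, fun x => ?_⟩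
    rw [conj_sphHarm, show -m = (m.natAbs : ℤ) by omega, h x]
    ring

/-- A real function orthogonal to the real harmonics is, once complexified, orthogonal to the
complex ones, hence zero. -/
theorem realDict_complete : (Submodule.span ℝ (Set.range realDict))ᗮ = ⊥ := by
  rw [eq_bot_iff]
  intro f hf
  have hreal : ∀ (l : ℕ) (m : ℤ), m.natAbs ≤ l →
      ∫ x, realSphHarm l m x * f x ∂surface = 0 := by
    intro l m hm
    have h := hf (realDict ⟨l, m, hm⟩) (Submodule.subset_span ⟨_, rfl⟩)
    rw [L2.inner_def] at h
    rw [← h]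
    refine integral_congr_ae ?_
    filter_upwards [ContinuousMap.coeFn_toLp (p := 2) (𝕜 := ℝ) surface
      (⟨realSphHarm l m, continuous_realSphHarm l m⟩ : C(S2, ℝ))] with x hx
    rw [realDict, hx]
    simp [mul_comm]
  have hint : ∀ (l : ℕ) (m : ℤ), Integrable (fun x => realSphHarm l m x * f x) surface := by
    intro l m
    exact ((continuous_realSphHarm l m).memLp_of_hasCompactSupport
      (HasCompactSupport.of_compactSpace _)).integrable_mul (p := 2) (q := 2) (Lp.memLp f)
  have hF : MemLp (fun x => (f x : ℂ)) 2 surface := (Lp.memLp f).ofReal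
  have hzero : hF.toLp _ = 0 := by
    rw [← Submodule.mem_bot ℂ, ← complexDict_complete, Submodule.mem_orthogonal]
    intro g hg
    induction hg using Submodule.span_induction with
    | mem g hg =>
      obtain ⟨⟨l, m, hm⟩, rfl⟩ := hg
      obtain ⟨α, β, h⟩ := exists_conj_sphHarm_eq l m
      rw [L2.inner_def]
      calc _ = ∫ x, (α * ((realSphHarm l m.natAbs x * f x : ℝ) : ℂ) +
            β * ((realSphHarm l (-(m.natAbs : ℤ)) x * f x : ℝ) : ℂ)) ∂surface := by
            refine integral_congr_ae ?_
            filter_upwards [hF.coeFn_toLp, ContinuousMap.coeFn_toLp (p := 2) (𝕜 := ℂ) surface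
              (⟨sphHarm l m, continuous_sphHarm l m⟩ : C(S2, ℂ))] with x hx1 hx2
            rw [hx1, complexDict, hx2]
            simp only [RCLike.inner_apply, ContinuousMap.coe_mk, h x]
            push_cast
            ring
        _ = 0 := by
            rw [integral_add ((hint _ _).ofReal.const_mul _) ((hint _ _).ofReal.const_mul _),
              integral_const_mul, integral_const_mul, integral_complex_ofReal,
              integral_complex_ofReal, hreal _ _ (by omega), hreal _ _ (by omega)]
            simp
    | zero => simp
    | add g g' _ _ hg hg' => rw [inner_add_left, hg, hg', add_zero]
    | smul c g _ hg => rw [inner_smul_left, hg, mul_zero]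
  rw [Submodule.mem_bot, Lp.eq_zero_iff_ae_eq_zero]
  rw [Lp.eq_zero_iff_ae_eq_zero] at hzero
  filter_upwards [hzero, hF.coeFn_toLp] with x h1 h2
  rw [h2] at h1
  simpa using h1

end Completeness

/-! ### Square integrability of the realizations -/

section Isotropy

/-- Rotations act transitively on the sphere up to antipodes. -/
theorem exists_rotate_eq (p x : S2) (hx : (p : E3) + x ≠ 0) :
    ∃ g : E3 ≃ₗᵢ[ℝ] E3, LinearMap.det (g.toLinearEquiv : E3 →ₗ[ℝ] E3) = 1 ∧ rotate g p = x := by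
  set K : Submodule ℝ E3 := (ℝ ∙ ((p : E3) - -(x : E3)))ᗮ with hK
  have hv : (p : E3) - -(x : E3) ≠ 0 := by simpa using hx
  -- The reflection sends `p` to `-x` and negation sends that to `x`; in dimension three both have
  -- determinant `-1`.
  refine ⟨K.reflection.trans (LinearIsometryEquiv.neg ℝ), ?_, ?_⟩
  · have h1 : ((K.reflection.trans (LinearIsometryEquiv.neg ℝ)).toLinearEquiv : E3 →ₗ[ℝ] E3) =
        (-1 : ℝ) • K.reflection.toLinearMap := by
      ext v; simp
    have h2 : Module.finrank ℝ Kᗮ = 1 := by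
      rw [hK, Submodule.orthogonal_orthogonal, finrank_span_singleton hv]
    rw [h1, LinearMap.det_smul, Submodule.det_reflection, h2]
    simp
    norm_num
  · refine Subtype.ext ?_
    have h := Submodule.reflection_sub (v := (p : E3)) (w := -(x : E3)) (by simp)
    simp only [rotate, LinearIsometryEquiv.trans_apply, hK, h]
    simp

variable {Ω : Type*} [MeasurableSpace Ω] {P : Measure Ω} {T : Ω → S2 → ℝ}

theorem IsIsotropic.lintegral_sq_eq (hIso : IsIsotropic P T)
    (hT : Measurable (Function.uncurry T)) (p x : S2) (hx : (p : E3) + x ≠ 0) :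
    ∫⁻ ω, ‖T ω x‖ₑ ^ (2 : ℝ) ∂P = ∫⁻ ω, ‖T ω p‖ₑ ^ (2 : ℝ) ∂P := by
  obtain ⟨g, hg, rfl⟩ := exists_rotate_eq p x hx
  have hTx : ∀ y, Measurable fun ω => T ω y := fun y => hT.comp measurable_prodMk_right
  have hm : Measurable fun h : S2 → ℝ => ‖h p‖ₑ ^ (2 : ℝ) := by fun_prop
  have h1 := lintegral_map (μ := P) hm (measurable_pi_lambda _ hTx)
  have h2 := lintegral_map (μ := P) hm (measurable_pi_lambda _ fun y => hTx (rotate g y))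
  rw [hIso g hg] at h2
  exact h2.symm.trans h1

/-- The realizations of a Gaussian isotropic field are square integrable. -/
theorem IsIsotropic.ae_memLp [IsProbabilityMeasure P] (hIso : IsIsotropic P T)
    (hT : Measurable (Function.uncurry T)) (hGauss : IsGaussianProcess (fun x ω => T ω x) P) :
    ∀ᵐ ω ∂P, MemLp (T ω) 2 surface := by
  have hfin : ∀ x, ∫⁻ ω, ‖T ω x‖ₑ ^ (2 : ℝ) ∂P < ∞ := by
    intro x
    have h := (hGauss.hasGaussianLaw_eval x).memLp_two.2
    rw [eLpNorm_lt_top_iff_lintegral_rpow_enorm_lt_top two_ne_zero ENNReal.ofNat_ne_top] at h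
    simpa using h
  let p : S2 := ⟨EuclideanSpace.single 0 1, by simp⟩
  -- The rotation from `exists_rotate_eq` misses only the antipode of `p`, whose second moment is
  -- therefore put into the bound.
  have hbound : ∀ x, ∫⁻ ω, ‖T ω x‖ₑ ^ (2 : ℝ) ∂P ≤
      max (∫⁻ ω, ‖T ω p‖ₑ ^ (2 : ℝ) ∂P) (∫⁻ ω, ‖T ω (-p)‖ₑ ^ (2 : ℝ) ∂P) := by
    intro x
    by_cases hx : (p : E3) + x = 0
    · rw [show x = -p from Subtype.ext (by simpa using eq_neg_of_add_eq_zero_right hx)]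
      exact le_max_right _ _
    · rw [hIso.lintegral_sq_eq hT p x hx]
      exact le_max_left _ _
  have hmeas : Measurable (Function.uncurry fun ω x => ‖T ω x‖ₑ ^ (2 : ℝ)) :=
    hT.enorm.pow_const _
  have htot : ∫⁻ ω, ∫⁻ x, ‖T ω x‖ₑ ^ (2 : ℝ) ∂surface ∂P ≠ ∞ := by
    rw [lintegral_lintegral_swap hmeas.aemeasurable]
    refine ((lintegral_mono hbound).trans_lt ?_).ne
    rw [lintegral_const]
    exact ENNReal.mul_lt_top (max_lt (hfin p) (hfin (-p))) (measure_lt_top _ _)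
  filter_upwards [ae_lt_top (Measurable.lintegral_prod_right hmeas) htot] with ω h
  refine ⟨(hT.comp measurable_prodMk_left).aestronglyMeasurable, ?_⟩
  rw [eLpNorm_lt_top_iff_lintegral_rpow_enorm_lt_top two_ne_zero ENNReal.ofNat_ne_top]
  simpa using h

end Isotropy

end SphericalL1

end

theorem mainTheorem5 {Ω : Type*} [MeasurableSpace Ω] (P : Measure Ω) [IsProbabilityMeasure P]
    (T : Ω → SphericalL1.S2 → ℝ) (hT : Measurable (Function.uncurry T))
    (hGauss : IsGaussianProcess (fun x ω => T ω x) P)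
    (hIso : SphericalL1.IsIsotropic P T)
    (δ ε : ℝ) (hδ : 0 < δ) (hε : 0 < ε) :
    (∃ lam : ℝ, 0 < lam ∧ ∃ a : Ω → SphericalL1.Coeffs ℂ,
      (∀ i, Measurable fun ω => a ω i) ∧
      (∀ᵐ ω ∂P, ∀ b, SphericalL1.IsPenalizedSolution SphericalL1.complexDict lam (T ω) b ↔
        b = a ω) ∧
      (∀ᵐ ω ∂P, SphericalL1.IsConstrainedSolution SphericalL1.complexDict
        (SphericalL1.residual SphericalL1.complexDict (T ω) (a ω)) (T ω) (a ω)) ∧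
      ENNReal.ofReal (1 - δ) ≤
        P {ω | SphericalL1.residual SphericalL1.complexDict (T ω) (a ω) < ENNReal.ofReal ε}) ∧
    (∃ lam : ℝ, 0 < lam ∧ ∃ a : Ω → SphericalL1.Coeffs ℝ,
      (∀ i, Measurable fun ω => a ω i) ∧
      (∀ᵐ ω ∂P, ∀ b, SphericalL1.IsPenalizedSolution SphericalL1.realDict lam (T ω) b ↔
        b = a ω) ∧
      (∀ᵐ ω ∂P, SphericalL1.IsConstrainedSolution SphericalL1.realDict
        (SphericalL1.residual SphericalL1.realDict (T ω) (a ω)) (T ω) (a ω)) ∧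
      ENNReal.ofReal (1 - δ) ≤
        P {ω | SphericalL1.residual SphericalL1.realDict (T ω) (a ω) < ENNReal.ofReal ε}) := by
  have hL2 := hIso.ae_memLp hT hGauss
  exact ⟨SphericalL1.exists_penalty_of_orthonormal SphericalL1.orthonormal_complexDict
      SphericalL1.complexDict_complete P T hT hL2 hδ hε,
    SphericalL1.exists_penalty_of_orthonormal SphericalL1.orthonormal_realDict
      SphericalL1.realDict_complete P T hT hL2 hδ hε⟩
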